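/- **Theorem (Correlator formula).** *Process.* Let $b,\sigma:\mathbb R\to\mathbb R$ be measurable and let $\ell$ be a transition kernel on $\mathbb R$ with $\ell(x,\{0\})=0$ and $\int_{\mathbb R}|z|\wedge|z|^2\,\ell(x,dz)<\infty$ for all $x$. Put $$\mathcal G f(x)=b(x)f'(x)+\tfrac12\sigma^2(x)f''(x)+\int_{\mathbb R}\big(f(x+z)-f(x)-f'(x)z\big)\,\ell(x,dz).$$ Assume that $\mathcal G$ is polynomial: $\int_{\mathbb R}|z|^k\,\ell(x,dz)<\infty$ for all $x$ and $k\ge2$, $\mathcal G0=0$, and for every $k\in\mathbb N$ the operator $\mathcal G$ maps polynomials of degree at most $k$ to polynomials of degree at most $k$. Let $Y$ be a real-valued adapted càdlàg process on a filtered probability space $(\Omega,\mathcal F,(\mathcal F_t)_{t\ge0},\mathbb P)$ with $Y(0)=y\in\mathbb R$ almost surely and with extended generator $\mathcal G$, that is, for every bounded $C^2$ function $f$ the process $f(Y(t))-f(y)-\int_0^t\mathcal Gf(Y(u))\,du$ is a local martingale. *Matrices.* Let $H_k(x)=(1,x,\dots,x^k)^\top$. Write $\otimes$ for the Kronecker product,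 $A\otimes^dB=A^{\otimes d}\otimes B$ (so $A\otimes^0B=B$), $vec$ for the stacking of the columns of a matrix, $vec^{-1}$ for its inverse, $e_{k,j}$ for the $j$-th canonical basis vector of $\mathbb R^k$ and $I_k$ for the identity matrix. For $n,r\ge0$ let $X_n^{(r)}(x)=H_n(x)^\top\otimes^rH_n(x)\in\mathbb R^{(n+1)\times(n+1)^r}$. For $a,c\ge1$ let $$E_{a,c}=\sum_{i=1}^a e_{a+c-1,i}\otimes e_{c,1}^\top\otimes e_{a,i}^\top+\sum_{i=2}^c e_{a+c-1,a+i-1}\otimes e_{c,i}^\top\otimes e_{a,a}^\top,\qquad D_{a,c}=\sum_{i=1}^a\sum_{j=1}^c e_{a+c-1,i+j-1}^\top\otimes e_{c,j}\otimes e_{a,i},$$ and let $E_{n+1}^{(0)}=D_{n+1}^{(0)}=I_{n+1}$ and, for $r\ge1$, $E_{n+1}^{(r)}=E_{nr+1,n+1}(I_{n+1}\otimes E_{n+1}^{(r-1)})$ and $D_{n+1}^{(r)}=(I_{n+1}\otimes D_{n+1}^{(r-1)})D_{nr+1,n+1}$ (so $E^{(1)}_{n+1}=E_{n+1,n+1}$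 and $D^{(1)}_{n+1}=D_{n+1,n+1}$). *Claim.* For every $k\ge0$ there is a (unique) generator matrix $G_k\in\mathbb R^{(k+1)\times(k+1)}$ with $\mathcal GH_k(x)=G_kH_k(x)$ for all $x$. Let $m,n\ge0$, let $p_0,\dots,p_m$ be real polynomials of degree at most $n$ with coefficient vectors $\vec p_0,\dots,\vec p_m\in\mathbb R^{n+1}$, and let $0\le t<s_0<s_1<\dots<s_m$. Put $\tilde G_n^{(r)}=D_{n+1}^{(r)}G_{n(r+1)}E_{n+1}^{(r)}\in\mathbb R^{(n+1)^{r+1}\times(n+1)^{r+1}}$; in particular $\tilde G_n^{(0)}=G_n$. Then $p_m(Y(s_0))\,p_{m-1}(Y(s_1))\cdots p_0(Y(s_m))$ is integrable and, almost surely, $$\mathbb E\big[p_m(Y(s_0))\,p_{m-1}(Y(s_1))\cdots p_0(Y(s_m))\,\big|\,\mathcal F_t\big]=\vec p_m^{\,\top}\Big\{vec^{-1}\circ e^{\tilde G_n^{(m)}(s_0-t)}\circ vec\big(X_n^{(m)}(Y(t))\big)\Big\}\prod_{k=1}^m e^{\tilde G_n^{(m-k)\top}(s_k-s_{k-1})}\big\{I_{n+1}\otimes^{m-k}\vec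 p_{m-k}\big\},$$ where the factors of the product are ordered from left to right by increasing $k$. Moreover, for all $r\ge0$ and $\tau,x\in\mathbb R$, $$e^{\tilde G_n^{(r)}\tau}\,vec\big(X_n^{(r)}(x)\big)=D_{n+1}^{(r)}e^{G_{n(r+1)}\tau}E_{n+1}^{(r)}\,vec\big(X_n^{(r)}(x)\big),\qquad e^{\tilde G_n^{(r)}\tau}=D_{n+1}^{(r)}e^{G_{n(r+1)}\tau}E_{n+1}^{(r)}+\big(I_{(n+1)^{r+1}}-D_{n+1}^{(r)}E_{n+1}^{(r)}\big),$$ and the correlator formula remains valid if every $e^{\tilde G_n^{(r)}\tau}$ in it is replaced by $D_{n+1}^{(r)}e^{G_{n(r+1)}\tau}E_{n+1}^{(r)}$ (and every $e^{\tilde G_n^{(r)\top}\tau}$ by the transpose of that matrix). -/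

import Mathlib

open MeasureTheory ProbabilityTheory Filter Topology
open scoped NNReal Polynomial Matrix Kronecker

namespace PolyCorr

noncomputable section

/-! ### Polynomial jump-diffusions -/

/-- The jump-diffusion operator
`𝒢 f(x) = b(x) f'(x) + ½ σ²(x) f''(x) + ∫ (f(x+z) - f(x) - f'(x) z) ℓ(x,dz)`. -/
def generator (b σ : ℝ → ℝ) (ℓ : Kernel ℝ ℝ) (f : ℝ → ℝ) (x : ℝ) : ℝ :=
  b x * deriv f x + 1 / 2 * (σ x) ^ 2 * deriv (deriv f) x
    + ∫ z, (f (x + z) - f x - deriv f x * z) ∂(ℓ x)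

/-- Conditions on the coefficients of a jump-diffusion operator: `b`, `σ` are measurable,
`ℓ(x,{0}) = 0` and `∫ |z| ∧ |z|² ℓ(x,dz) < ∞` for all `x`. -/
structure IsJumpDiffusionOperator (b σ : ℝ → ℝ) (ℓ : Kernel ℝ ℝ) : Prop where
  measurable_b : Measurable b
  measurable_σ : Measurable σ
  no_zero_jump : ∀ x, ℓ x {0} = 0
  integrable_min : ∀ x, Integrable (fun z : ℝ => min |z| (|z| ^ 2)) (ℓ x)

/-- The operator is polynomial: all jump moments of order at least two are finite, it annihilates
the zero function, and it maps polynomials of degree `≤ k` to polynomials of degree `≤ k`,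
for every `k`. -/
structure IsPolynomialOperator (b σ : ℝ → ℝ) (ℓ : Kernel ℝ ℝ) : Prop where
  integrable_pow : ∀ x, ∀ k : ℕ, 2 ≤ k → Integrable (fun z : ℝ => |z| ^ k) (ℓ x)
  map_zero : ∀ x, generator b σ ℓ (fun _ => 0) x = 0
  map_degree_le : ∀ k : ℕ, ∀ p : ℝ[X], p.natDegree ≤ k →
    ∃ q : ℝ[X], q.natDegree ≤ k ∧ ∀ x, generator b σ ℓ (fun u => p.eval u) x = q.eval x

/-- `M` is a local martingale. -/
def IsLocalMartingale {Ω : Type*} {mΩ : MeasurableSpace Ω} (M : ℝ≥0 → Ω → ℝ)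
    (𝓕 : Filtration ℝ≥0 mΩ) (P : Measure Ω) : Prop :=
  Locally (fun N => Martingale N 𝓕 P) 𝓕 M P

/-- `Y` is a jump-diffusion started at `y` with extended generator `𝒢`: an adapted càdlàg process
with `Y(0) = y` almost surely such that, for every bounded `C²` function `f`, the process
`f(Y(t)) - f(y) - ∫₀ᵗ 𝒢 f(Y(u)) du` is a local martingale. -/
structure IsJumpDiffusion {Ω : Type*} {mΩ : MeasurableSpace Ω} (b σ : ℝ → ℝ) (ℓ : Kernel ℝ ℝ)
    (𝓕 : Filtration ℝ≥0 mΩ) (P : Measure Ω) (y : ℝ) (Y : ℝ≥0 → Ω → ℝ) : Prop where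
  adapted : StronglyAdapted 𝓕 Y
  right_continuous : ∀ ω t, ContinuousWithinAt (fun u => Y u ω) (Set.Ici t) t
  left_limits : ∀ ω t, ∃ l : ℝ, Tendsto (fun u => Y u ω) (𝓝[<] t) (𝓝 l)
  initial : ∀ᵐ ω ∂P, Y 0 ω = y
  martingale_problem : ∀ f : ℝ → ℝ, ContDiff ℝ 2 f → (∃ C, ∀ x, |f x| ≤ C) →
    IsLocalMartingale
      (fun t ω => f (Y t ω) - f y
        - ∫ u in (0 : ℝ)..t, generator b σ ℓ f (Y u.toNNReal ω)) 𝓕 P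

/-! ### Matrix operations

All matrices have index sets `Fin a`, so they are honest elements of `ℝ^{a × b}`; the bijection
`finProdFinEquiv : Fin a × Fin c ≃ Fin (a * c)` is the lexicographic one, `(i, j) ↦ c * i + j`. -/

/-- Change of the description of the dimensions of a matrix. -/
def mcast {a b a' b' : ℕ} (ha : a = a') (hb : b = b') (A : Matrix (Fin a) (Fin b) ℝ) :
    Matrix (Fin a') (Fin b') ℝ :=
  A.submatrix (Fin.cast ha.symm) (Fin.cast hb.symm)

/-- Kronecker product of an `a × b` and a `c × d` matrix, as an `ac × bd` matrix. -/
def kron {a b c d : ℕ} (A : Matrix (Fin a) (Fin b) ℝ) (B : Matrix (Fin c) (Fin d) ℝ) :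
    Matrix (Fin (a * c)) (Fin (b * d)) ℝ :=
  Matrix.reindex finProdFinEquiv finProdFinEquiv (A ⊗ₖ B)

/-- Kronecker power `A^{⊗ d}`. -/
def kronPow {a b : ℕ} (A : Matrix (Fin a) (Fin b) ℝ) :
    (d : ℕ) → Matrix (Fin (a ^ d)) (Fin (b ^ d)) ℝ
  | 0 => mcast (pow_zero a).symm (pow_zero b).symm 1
  | d + 1 => mcast (pow_succ' a d).symm (pow_succ' b d).symm (kron A (kronPow A d))

/-- The `d`-Kronecker product `A ⊗^d B = A^{⊗ d} ⊗ B`, which is `B` for `d = 0`. -/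
def dKron {a b c e : ℕ} (d : ℕ) (A : Matrix (Fin a) (Fin b) ℝ) (B : Matrix (Fin c) (Fin e) ℝ) :
    Matrix (Fin (a ^ d * c)) (Fin (b ^ d * e)) ℝ :=
  kron (kronPow A d) B

/-- Vectorization of an `a × b` matrix: its columns stacked into one vector of length `N = ba`. -/
def vec {a b N : ℕ} (h : N = b * a) (A : Matrix (Fin a) (Fin b) ℝ) : Fin N → ℝ :=
  fun k => A.vec (finProdFinEquiv.symm (Fin.cast h k))

/-- Inverse vectorization: `[vec⁻¹ v]_{i,j} = v_{a j + i}` (indices from `0`). -/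
def vecInv {a b N : ℕ} (h : N = b * a) (v : Fin N → ℝ) : Matrix (Fin a) (Fin b) ℝ :=
  Matrix.of fun i j => v (Fin.cast h.symm (finProdFinEquiv (j, i)))

/-! ### Monomial basis and generator matrix -/

/-- `H_k(x) = (1, x, …, x^k)ᵀ` as a column. -/
def monomials (k : ℕ) (x : ℝ) : Matrix (Fin (k + 1)) (Fin 1) ℝ :=
  Matrix.of fun i _ => x ^ (i : ℕ)

/-- Column of the coefficients of `p` with respect to `1, x, …, x^n`. -/
def coeffCol (n : ℕ) (p : ℝ[X]) : Matrix (Fin (n + 1)) (Fin 1) ℝ :=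
  Matrix.of fun i _ => p.coeff i

/-- `𝒢 H_k(x) = M H_k(x)` for all `x`, where `𝒢` acts on each entry. -/
def IsGeneratorMatrix (b σ : ℝ → ℝ) (ℓ : Kernel ℝ ℝ) (k : ℕ)
    (M : Matrix (Fin (k + 1)) (Fin (k + 1)) ℝ) : Prop :=
  ∀ x : ℝ, (Matrix.of fun (i : Fin (k + 1)) (_ : Fin 1) =>
    generator b σ ℓ (fun u => u ^ (i : ℕ)) x) = M * monomials k x

open Classical in
/-- The generator matrix `G_k` of order `k`: the matrix with `𝒢 H_k = G_k H_k`. There is at most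
one, by linear independence of the monomials, and there is one when `𝒢` is polynomial. -/
def generatorMatrix (b σ : ℝ → ℝ) (ℓ : Kernel ℝ ℝ) (k : ℕ) :
    Matrix (Fin (k + 1)) (Fin (k + 1)) ℝ :=
  if h : ∃ M, IsGeneratorMatrix b σ ℓ k M then h.choose else 0

/-! ### Eliminating and duplicating matrices -/

/-- The L-eliminating matrix `E_{a+1,b+1}`, which maps `vec A` to the first column of `A` followed
by the last row of `A` without its first entry, for `A` of size `(a+1) × (b+1)`.
`Matrix.single k (finProdFinEquiv (j, i)) 1` is `e_k ⊗ e_jᵀ ⊗ e_iᵀ`. -/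
def lElim (a b : ℕ) : Matrix (Fin (a + b + 1)) (Fin ((b + 1) * (a + 1))) ℝ :=
  (∑ i : Fin (a + 1), Matrix.single (⟨i, by omega⟩ : Fin (a + b + 1))
      (finProdFinEquiv ((0 : Fin (b + 1)), i)) (1 : ℝ))
    + ∑ j : Fin b, Matrix.single (⟨a + 1 + j, by omega⟩ : Fin (a + b + 1))
      (finProdFinEquiv (j.succ, Fin.last a)) (1 : ℝ)

/-- The L-duplicating matrix `D_{a+1,b+1}`. -/
def lDup (a b : ℕ) : Matrix (Fin ((b + 1) * (a + 1))) (Fin (a + b + 1)) ℝ :=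
  ∑ i : Fin (a + 1), ∑ j : Fin (b + 1),
    Matrix.single (finProdFinEquiv (j, i)) (⟨i + j, by omega⟩ : Fin (a + b + 1)) (1 : ℝ)

/-- The `r`-th L-eliminating matrix `E_{n+1}^{(r)}`. For `r = 0` it is the identity, and
`E^{(r+1)} = E_{n(r+1)+1,n+1} (I_{n+1} ⊗ E^{(r)})`; in particular `E^{(1)} = E_{n+1,n+1}`. -/
def elimMatrix (n : ℕ) :
    (r : ℕ) → Matrix (Fin (n * (r + 1) + 1)) (Fin ((n + 1) ^ (r + 1))) ℝ
  | 0 => mcast (a := n + 1) (b := n + 1) (by simp) (by simp) 1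
  | r + 1 => mcast rfl (pow_succ' (n + 1) (r + 1)).symm
      (lElim (n * (r + 1)) n * kron (1 : Matrix (Fin (n + 1)) (Fin (n + 1)) ℝ) (elimMatrix n r))

/-- The `r`-th L-duplicating matrix `D_{n+1}^{(r)}`. For `r = 0` it is the identity, and
`D^{(r+1)} = (I_{n+1} ⊗ D^{(r)}) D_{n(r+1)+1,n+1}`; in particular `D^{(1)} = D_{n+1,n+1}`. -/
def dupMatrix (n : ℕ) :
    (r : ℕ) → Matrix (Fin ((n + 1) ^ (r + 1))) (Fin (n * (r + 1) + 1)) ℝ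
  | 0 => mcast (a := n + 1) (b := n + 1) (by simp) (by simp) 1
  | r + 1 => mcast (pow_succ' (n + 1) (r + 1)).symm rfl
      (kron (1 : Matrix (Fin (n + 1)) (Fin (n + 1)) ℝ) (dupMatrix n r) * lDup (n * (r + 1)) n)

/-! ### The correlator formula -/

/-- `X_n^{(r)}(x) = H_n(x)ᵀ ⊗^r H_n(x)`, of size `(n+1) × (n+1)^r`. -/
def powMatrix (n r : ℕ) (x : ℝ) : Matrix (Fin (n + 1)) (Fin ((n + 1) ^ r)) ℝ :=
  mcast (by simp) (by simp) (dKron r (monomials n x)ᵀ (monomials n x))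

/-- `vec (X_n^{(r)}(x))`, of length `(n+1)^{r+1}`. -/
def vecPow (n r : ℕ) (x : ℝ) : Fin ((n + 1) ^ (r + 1)) → ℝ :=
  vec (pow_succ (n + 1) r) (powMatrix n r x)

/-- `I_{n+1} ⊗^r p`, with `p` identified with its column of coefficients,
of size `(n+1)^{r+1} × (n+1)^r`. -/
def idKronCoeff (n r : ℕ) (p : ℝ[X]) : Matrix (Fin ((n + 1) ^ (r + 1))) (Fin ((n + 1) ^ r)) ℝ :=
  mcast (pow_succ (n + 1) r).symm (by simp)
    (dKron r (1 : Matrix (Fin (n + 1)) (Fin (n + 1)) ℝ) (coeffCol n p))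

/-- `G̃_n^{(r)} = D_{n+1}^{(r)} G_{n(r+1)} E_{n+1}^{(r)}`. -/
def corrGenerator (b σ : ℝ → ℝ) (ℓ : Kernel ℝ ℝ) (n r : ℕ) :
    Matrix (Fin ((n + 1) ^ (r + 1))) (Fin ((n + 1) ^ (r + 1))) ℝ :=
  dupMatrix n r * generatorMatrix b σ ℓ (n * (r + 1)) * elimMatrix n r

/-- `e^{G̃_n^{(r)} τ}`. -/
def corrExp (b σ : ℝ → ℝ) (ℓ : Kernel ℝ ℝ) (n r : ℕ) (τ : ℝ) :
    Matrix (Fin ((n + 1) ^ (r + 1))) (Fin ((n + 1) ^ (r + 1))) ℝ :=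
  NormedSpace.exp (τ • corrGenerator b σ ℓ n r)

/-- `D_{n+1}^{(r)} e^{G_{n(r+1)} τ} E_{n+1}^{(r)}`. -/
def dupExpElim (b σ : ℝ → ℝ) (ℓ : Kernel ℝ ℝ) (n r : ℕ) (τ : ℝ) :
    Matrix (Fin ((n + 1) ^ (r + 1))) (Fin ((n + 1) ^ (r + 1))) ℝ :=
  dupMatrix n r * NormedSpace.exp (τ • generatorMatrix b σ ℓ (n * (r + 1))) * elimMatrix n r

/-- The ordered product `F (m-1) * F (m-2) * ⋯ * F 0`, where `F j` has size
`(n+1)^{j+1} × (n+1)^j`. -/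
def descProd (n : ℕ) (F : (j : ℕ) → Matrix (Fin ((n + 1) ^ (j + 1))) (Fin ((n + 1) ^ j)) ℝ) :
    (m : ℕ) → Matrix (Fin ((n + 1) ^ m)) (Fin ((n + 1) ^ 0)) ℝ
  | 0 => 1
  | m + 1 => F m * descProd n F m

/-- The `1 × 1` matrix
`p_mᵀ {vec⁻¹ ∘ M^{(m)}(s_0 - t) ∘ vec (X_n^{(m)}(x))}
  ∏_{k=1}^m M^{(m-k)}(s_k - s_{k-1})ᵀ {I_{n+1} ⊗^{m-k} p_{m-k}}`
for a family `M^{(r)}(τ)`, to be taken as `e^{G̃^{(r)} τ}`. The factor of index `k` in the product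
is the factor of index `j = m - k` in `descProd`. -/
def corrFormula (n m : ℕ) (p : ℕ → ℝ[X]) (t : ℝ≥0) (s : ℕ → ℝ≥0)
    (M : (r : ℕ) → ℝ → Matrix (Fin ((n + 1) ^ (r + 1))) (Fin ((n + 1) ^ (r + 1))) ℝ) (x : ℝ) :
    Matrix (Fin 1) (Fin ((n + 1) ^ 0)) ℝ :=
  (coeffCol n (p m))ᵀ
    * vecInv (pow_succ (n + 1) m) (M m ((s 0 : ℝ) - t) *ᵥ vecPow n m x)
    * descProd n (fun j => (M j ((s (m - j) : ℝ) - s (m - j - 1)))ᵀ * idKronCoeff n j (p j)) m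

end

end PolyCorr

open PolyCorr

namespace PolyCorr

noncomputable section

/-! ### Kronecker calculus -/

/-! The vector `vec (X_n^{(r)}(x))` is the tensor power of `H_n(x)` with `r + 1` factors
(`vecPow_eq_tensorMonomials`). Its entries are monomials of degree at most `n(r+1)`, with
repetitions. The duplicating matrix `D` creates these repetitions from `H_{n(r+1)}(x)`
(`dupMatrix_mulVec`), and the eliminating matrix `E` removes them, since `E D = 1`
(`elimMatrix_mul_dupMatrix`). Hence `(D G E)^k = D G^k E` for `k ≥ 1`, and only the zeroth term of
the exponential series differs, which gives `corrExp_eq`. The correction `1 - D E` vanishes on the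
range of `D`, so on the vectors that occur in the formula both families of matrices act alike.

The probabilistic input is the moment formula `IsJumpDiffusion.condExp_pow`. The martingale problem
is given only for bounded `C²` functions, so monomials are reached by approximation. Applying `𝒢` to
`(u - x)^k` at `u = x` shows that `b`, `σ²` and the even jump moments grow at most polynomially. For
`V = (1 + x²)^k` one has `𝒢V ≤ CV`; concavity of `v ↦ v/(1 + εv)` transfers this inequality to the
bounded function `V/(1 + εV)`, and Grönwall and Fatou give finite moments
(`IsJumpDiffusion.exists_moment_le`). The powers of `sin(εx)/ε` are bounded and have derivatives of
polynomial growth uniformly in `ε ≤ 1`, so Dynkin's formula passes to monomials as `ε → 0`.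
Integrated over an event of the past it is a closed linear integral equation with matrix `G_k`,
whose only bounded solution is the matrix exponential.

The correlator is then computed backwards in time. If the conditional expectation of the last `j`
factors is a linear functional of the `j`-fold tensor power of `H_n(Y)`, multiplication by one more
polynomial is contraction of one additional tensor factor, that is `I ⊗^j p_j`, and conditioning on
an earlier time applies `D e^{Gτ} E` (`IsJumpDiffusion.condExp_eval_mul`). Iteration gives
`IsJumpDiffusion.condExp_prod_eq_corrFormula`. -/

lemma kron_apply {a b c d : ℕ} (A : Matrix (Fin a) (Fin b) ℝ) (B : Matrix (Fin c) (Fin d) ℝ)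
    (i : Fin a) (j : Fin c) (k : Fin b) (l : Fin d) :
    kron A B (finProdFinEquiv (i, j)) (finProdFinEquiv (k, l)) = A i k * B j l := by
  simp [kron]

/-- Index of `Fin ((n+1)^(r+1))` with leading digit `i` and remaining digits `j`. -/
def consIdx {n r : ℕ} (i : Fin (n + 1)) (j : Fin ((n + 1) ^ r)) : Fin ((n + 1) ^ (r + 1)) :=
  Fin.cast (pow_succ' (n + 1) r).symm (finProdFinEquiv (i, j))

/-- Index of `Fin ((n+1)^(r+1))` with leading digits `j` and last digit `i`. -/
def snocIdx {n r : ℕ} (j : Fin ((n + 1) ^ r)) (i : Fin (n + 1)) : Fin ((n + 1) ^ (r + 1)) :=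
  Fin.cast (pow_succ (n + 1) r).symm (finProdFinEquiv (j, i))

lemma consIdx_val {n r : ℕ} (i : Fin (n + 1)) (j : Fin ((n + 1) ^ r)) :
    (consIdx i j : ℕ) = j + (n + 1) ^ r * i := by
  simp [consIdx, finProdFinEquiv_apply_val]

lemma snocIdx_val {n r : ℕ} (j : Fin ((n + 1) ^ r)) (i : Fin (n + 1)) :
    (snocIdx j i : ℕ) = i + (n + 1) * j := by
  simp [snocIdx, finProdFinEquiv_apply_val]

lemma exists_consIdx {n r : ℕ} (k : Fin ((n + 1) ^ (r + 1))) :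
    ∃ (i : Fin (n + 1)) (j : Fin ((n + 1) ^ r)), k = consIdx i j :=
  ⟨(finProdFinEquiv.symm (Fin.cast (pow_succ' (n + 1) r) k)).1,
    (finProdFinEquiv.symm (Fin.cast (pow_succ' (n + 1) r) k)).2, by
      rw [consIdx, Prod.mk.eta, Equiv.apply_symm_apply]; rfl⟩

lemma exists_snocIdx {n r : ℕ} (k : Fin ((n + 1) ^ (r + 1))) :
    ∃ (j : Fin ((n + 1) ^ r)) (i : Fin (n + 1)), k = snocIdx j i :=
  ⟨(finProdFinEquiv.symm (Fin.cast (pow_succ (n + 1) r) k)).1,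
    (finProdFinEquiv.symm (Fin.cast (pow_succ (n + 1) r) k)).2, by
      rw [snocIdx, Prod.mk.eta, Equiv.apply_symm_apply]; rfl⟩

/-- Associativity of the lexicographic numbering. It mediates between `kronPow`, `elimMatrix` and
`dupMatrix`, which split off the first tensor factor, and `vec` and `idKronCoeff`, which split off
the last. -/
lemma snocIdx_consIdx {n r : ℕ} (i : Fin (n + 1)) (j : Fin ((n + 1) ^ r)) (k : Fin (n + 1)) :
    snocIdx (consIdx i j) k = consIdx i (snocIdx j k) := by
  ext
  simp only [snocIdx_val, consIdx_val]
  ring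

lemma sum_snocIdx {n r : ℕ} (f : Fin ((n + 1) ^ (r + 1)) → ℝ) :
    ∑ k, f k = ∑ j : Fin ((n + 1) ^ r), ∑ i : Fin (n + 1), f (snocIdx j i) := by
  rw [← Fintype.sum_prod_type' (f := fun j i => f (snocIdx j i))]
  exact (Equiv.sum_comp (finProdFinEquiv.trans (finCongr (pow_succ (n + 1) r).symm)) f).symm

/-- The entries of the Kronecker power `H_n(x)^{⊗ r}`. -/
def tensorMonomials (n r : ℕ) (x : ℝ) (k : Fin ((n + 1) ^ r)) : ℝ :=
  kronPow (monomials n x)ᵀ r ⟨0, by simp⟩ k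

lemma tensorMonomials_zero (n : ℕ) (x : ℝ) (k : Fin ((n + 1) ^ 0)) :
    tensorMonomials n 0 x k = 1 := by
  have : k = ⟨0, by simp⟩ := by
    ext; have := k.2; simp at this; simpa using this
  subst this
  simp only [tensorMonomials, kronPow, mcast, Matrix.submatrix_apply]
  exact Matrix.one_apply_eq _

lemma tensorMonomials_consIdx (n r : ℕ) (x : ℝ) (i : Fin (n + 1)) (j : Fin ((n + 1) ^ r)) :
    tensorMonomials n (r + 1) x (consIdx i j) = x ^ (i : ℕ) * tensorMonomials n r x j := by
  have h0 : (Fin.cast (pow_succ' 1 r) (⟨0, by simp⟩ : Fin (1 ^ (r + 1)))) =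
      finProdFinEquiv ((0 : Fin 1), (⟨0, by simp⟩ : Fin (1 ^ r))) := by
    ext; simp
  simp only [tensorMonomials, kronPow, mcast, Matrix.submatrix_apply, consIdx, h0, Fin.cast_cast,
    Fin.cast_refl]
  erw [kron_apply]
  simp [monomials]

lemma vecPow_snocIdx (n r : ℕ) (x : ℝ) (j : Fin ((n + 1) ^ r)) (i : Fin (n + 1)) :
    vecPow n r x (snocIdx j i) = tensorMonomials n r x j * x ^ (i : ℕ) := by
  have h1 : (Fin.cast (by simp) i : Fin (1 ^ r * (n + 1))) =
      finProdFinEquiv ((⟨0, by simp⟩ : Fin (1 ^ r)), i) := by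
    ext; simp
  have h2 : (Fin.cast (by simp) j : Fin ((n + 1) ^ r * 1)) =
      finProdFinEquiv (j, (0 : Fin 1)) := by
    ext; simp
  simp only [vecPow, vec, snocIdx, Fin.cast_cast, Fin.cast_refl, Equiv.symm_apply_apply,
    Matrix.vec, powMatrix, mcast, Matrix.submatrix_apply, dKron, id]
  rw [h1, h2, kron_apply]
  simp [tensorMonomials, monomials]

/-- Stacking the columns of `(Hᵀ)^{⊗r} ⊗ H` appends a last tensor factor, whereas `kronPow` prepends
a first one; for powers of the single vector `H` the results agree. -/
lemma vecPow_eq_tensorMonomials (n r : ℕ) (x : ℝ) :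
    vecPow n r x = tensorMonomials n (r + 1) x := by
  induction r with
  | zero =>
    ext k
    obtain ⟨j, i, rfl⟩ := exists_snocIdx k
    have : snocIdx j i = consIdx i j := by
      have hj : (j : ℕ) = 0 := by have := j.2; simp only [pow_zero] at this; omega
      ext; rw [snocIdx_val, consIdx_val, hj]; ring
    rw [vecPow_snocIdx, this, tensorMonomials_consIdx, mul_comm]
  | succ r ih =>
    ext k
    obtain ⟨j, i, rfl⟩ := exists_snocIdx k
    obtain ⟨j, l, rfl⟩ := exists_consIdx j
    rw [vecPow_snocIdx, snocIdx_consIdx, tensorMonomials_consIdx, tensorMonomials_consIdx, ← ih,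
      vecPow_snocIdx]
    ring

lemma tensorMonomials_snocIdx (n r : ℕ) (x : ℝ) (j : Fin ((n + 1) ^ r)) (i : Fin (n + 1)) :
    tensorMonomials n (r + 1) x (snocIdx j i) = tensorMonomials n r x j * x ^ (i : ℕ) := by
  rw [← vecPow_eq_tensorMonomials, vecPow_snocIdx]

/-! ### Elimination and duplication -/

lemma lElim_mulVec (a b : ℕ) (v : Fin ((b + 1) * (a + 1)) → ℝ) (k : Fin (a + b + 1)) :
    (lElim a b *ᵥ v) k = if h : (k : ℕ) < a + 1 then v (finProdFinEquiv (0, ⟨k, h⟩))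
      else v (finProdFinEquiv (⟨k - a, by omega⟩, Fin.last a)) := by
  simp only [lElim, Matrix.add_mulVec, Matrix.sum_mulVec, Pi.add_apply, Finset.sum_apply,
    Matrix.single_mulVec, one_mul, Function.update_apply, Pi.zero_apply]
  split_ifs with h
  · rw [Finset.sum_eq_single ⟨k, h⟩, Finset.sum_eq_zero]
    · simp
    · intro j _
      rw [if_neg]
      intro hk
      have := congrArg Fin.val hk
      simp at this; omega
    · intro i _ hi
      rw [if_neg]
      rintro rfl
      simp at hi
    · simp
  -- Here `k ≥ a + 1`, so the column `k - a` is positive, and the second sum of `lElim` indexes it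
  -- by its predecessor.
  · rw [Finset.sum_eq_zero, Finset.sum_eq_single ⟨k - a - 1, by omega⟩]
    · have : k = ⟨a + 1 + (k - a - 1), by omega⟩ := by ext; simp; omega
      rw [if_pos this, zero_add]
      congr 3
      ext; simp; omega
    · intro i _ hi
      rw [if_neg]
      intro hk
      apply hi
      have := congrArg Fin.val hk
      ext; simp at this ⊢; omega
    · simp
    · intro i _
      rw [if_neg]
      intro hk
      have := congrArg Fin.val hk
      simp at this; omega

lemma lDup_mulVec (a b : ℕ) (v : Fin (a + b + 1) → ℝ) (j : Fin (b + 1)) (i : Fin (a + 1)) :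
    (lDup a b *ᵥ v) (finProdFinEquiv (j, i)) = v ⟨i + j, by omega⟩ := by
  simp only [lDup, Matrix.sum_mulVec, Finset.sum_apply,
    Matrix.single_mulVec, one_mul, Function.update_apply, Pi.zero_apply,
    EmbeddingLike.apply_eq_iff_eq, Prod.mk.injEq]
  rw [Finset.sum_eq_single i, Finset.sum_eq_single j]
  · simp
  · intro j' _ hj; rw [if_neg]; rintro ⟨rfl, -⟩; exact hj rfl
  · simp
  · intro i' _ hi; apply Finset.sum_eq_zero; intro j' _; rw [if_neg]; rintro ⟨-, rfl⟩; exact hi rfl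
  · simp

/-- `lDup` writes the `k`-th coordinate on the whole antidiagonal `i + j = k`; the first column
followed by the rest of the last row meets each antidiagonal exactly once. -/
lemma lElim_mul_lDup (a b : ℕ) : lElim a b * lDup a b = 1 := by
  apply Matrix.ext_of_mulVec_single
  intro c
  rw [← Matrix.mulVec_mulVec, Matrix.one_mulVec]
  ext k
  rw [lElim_mulVec]
  split_ifs with h
  · rw [lDup_mulVec]; simp
  · rw [lDup_mulVec]
    congr 1
    ext; simp; omega

lemma kron_mul_kron {a b c d e f : ℕ} (A : Matrix (Fin a) (Fin b) ℝ) (B : Matrix (Fin c) (Fin d) ℝ)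
    (A' : Matrix (Fin b) (Fin e) ℝ) (B' : Matrix (Fin d) (Fin f) ℝ) :
    kron A B * kron A' B' = kron (A * A') (B * B') := by
  simp only [kron, Matrix.reindex_apply, Matrix.submatrix_mul_equiv, ← Matrix.mul_kronecker_mul]

lemma kron_one_one (a b : ℕ) :
    kron (1 : Matrix (Fin a) (Fin a) ℝ) (1 : Matrix (Fin b) (Fin b) ℝ) = 1 := by
  simp [kron]

lemma mcast_mul_mcast {a b c a' b' c' : ℕ} (ha : a = a') (hb : b = b') (hc : c = c')
    (A : Matrix (Fin a) (Fin b) ℝ) (B : Matrix (Fin b) (Fin c) ℝ) :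
    mcast ha hb A * mcast hb hc B = mcast ha hc (A * B) := by
  subst ha hb hc; rfl

lemma mcast_one {a a' : ℕ} (ha ha' : a = a') :
    mcast ha ha' (1 : Matrix (Fin a) (Fin a) ℝ) = 1 := by
  subst ha; rfl

lemma mcast_mulVec {a b a' b' : ℕ} (ha : a = a') (hb : b = b')
    (A : Matrix (Fin a) (Fin b) ℝ) (v : Fin b' → ℝ) (k : Fin a') :
    (mcast ha hb A *ᵥ v) k = (A *ᵥ (fun i => v (Fin.cast hb i))) (Fin.cast ha.symm k) := by
  subst ha hb; rfl

/-- In the recursive definitions the two inner Kronecker factors meet and cancel by the mixed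
product rule and induction, which leaves `lElim_mul_lDup`. -/
lemma elimMatrix_mul_dupMatrix (n r : ℕ) : elimMatrix n r * dupMatrix n r = 1 := by
  induction r with
  | zero => rw [elimMatrix, dupMatrix, mcast_mul_mcast, one_mul, mcast_one]
  | succ r ih =>
    rw [elimMatrix, dupMatrix, mcast_mul_mcast, Matrix.mul_assoc, ← Matrix.mul_assoc (kron _ _),
      kron_mul_kron, ih, one_mul, kron_one_one, Matrix.one_mul, lElim_mul_lDup]
    rfl

lemma kron_mulVec {a b c d : ℕ} (A : Matrix (Fin a) (Fin b) ℝ) (B : Matrix (Fin c) (Fin d) ℝ)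
    (u : Fin b → ℝ) (w : Fin d → ℝ) (v : Fin (b * d) → ℝ)
    (hv : ∀ k l, v (finProdFinEquiv (k, l)) = u k * w l) (i : Fin a) (j : Fin c) :
    (kron A B *ᵥ v) (finProdFinEquiv (i, j)) = (A *ᵥ u) i * (B *ᵥ w) j := by
  simp only [Matrix.mulVec, dotProduct]
  rw [← Equiv.sum_comp finProdFinEquiv, Fintype.sum_prod_type, Finset.sum_mul_sum]
  refine Finset.sum_congr rfl fun k _ => Finset.sum_congr rfl fun l _ => ?_
  rw [kron_apply, hv]; ring

lemma tensorMonomials_one (n : ℕ) (x : ℝ) (k : Fin ((n + 1) ^ 1)) :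
    tensorMonomials n 1 x k = x ^ (k : ℕ) := by
  obtain ⟨i, j, rfl⟩ := exists_consIdx k
  have hj : (j : ℕ) = 0 := by have := j.2; simp only [pow_zero] at this; omega
  rw [tensorMonomials_consIdx, tensorMonomials_zero]
  rw [consIdx_val, hj, mul_one]; congr 1; ring

/-- By `x^{i+j} = x^i x^j`, one application of `lDup` to a monomial vector is a tensor product of
two monomial vectors; the recursion expands the longer one further. -/
lemma dupMatrix_mulVec (n r : ℕ) (x : ℝ) :
    dupMatrix n r *ᵥ (fun k => x ^ (k : ℕ)) = tensorMonomials n (r + 1) x := by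
  induction r with
  | zero =>
    ext k
    rw [dupMatrix, mcast_mulVec, tensorMonomials_one, Matrix.one_mulVec]
    simp
  | succ r ih =>
    ext k
    obtain ⟨i, j, rfl⟩ := exists_consIdx k
    have hk : Fin.cast (pow_succ' (n + 1) (r + 1)).symm.symm (consIdx i j)
      = finProdFinEquiv (i, j) := rfl
    rw [dupMatrix, mcast_mulVec, ← Matrix.mulVec_mulVec, hk,
      kron_mulVec _ _ (fun k => x ^ (k : ℕ)) (fun k => x ^ (k : ℕ)), ih,
      tensorMonomials_consIdx, Matrix.one_mulVec]
    intro k l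
    rw [lDup_mulVec]
    simp [pow_add, mul_comm]

lemma elimMatrix_mulVec (n r : ℕ) (x : ℝ) :
    elimMatrix n r *ᵥ tensorMonomials n (r + 1) x
      = fun k : Fin (n * (r + 1) + 1) => x ^ (k : ℕ) := by
  rw [← dupMatrix_mulVec, Matrix.mulVec_mulVec, elimMatrix_mul_dupMatrix, Matrix.one_mulVec]

/-- Adjacent factors `E D` collapse. The exponent starts at one because the zeroth power is `1`,
whereas `D E` is in general only a projection. -/
lemma pow_dup_elim {a N : ℕ} (D : Matrix (Fin N) (Fin a) ℝ) (E : Matrix (Fin a) (Fin N) ℝ)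
    (hED : E * D = 1) (G : Matrix (Fin a) (Fin a) ℝ) (k : ℕ) :
    (D * G * E) ^ (k + 1) = D * G ^ (k + 1) * E := by
  induction k with
  | zero => simp
  | succ k ih =>
    rw [pow_succ, ih, pow_succ G (k + 1)]
    calc D * G ^ (k + 1) * E * (D * G * E)
        = D * G ^ (k + 1) * (E * D) * G * E := by simp only [Matrix.mul_assoc]
      _ = _ := by rw [hED, Matrix.mul_one, Matrix.mul_assoc D]

lemma exp_dup_elim {a N : ℕ} (D : Matrix (Fin N) (Fin a) ℝ) (E : Matrix (Fin a) (Fin N) ℝ)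
    (hED : E * D = 1) (G : Matrix (Fin a) (Fin a) ℝ) :
    NormedSpace.exp (D * G * E) = D * NormedSpace.exp G * E + (1 - D * E) := by
  let (k : ℕ) : NormedRing (Matrix (Fin k) (Fin k) ℝ) := Matrix.linftyOpNormedRing
  let (k : ℕ) : NormedAlgebra ℝ (Matrix (Fin k) (Fin k) ℝ) := Matrix.linftyOpNormedAlgebra
  have h1 := NormedSpace.exp_series_hasSum_exp' (𝕂 := ℝ) (D * G * E)
  have h2 := NormedSpace.exp_series_hasSum_exp' (𝕂 := ℝ) G
  let φ : Matrix (Fin a) (Fin a) ℝ →+ Matrix (Fin N) (Fin N) ℝ :=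
    { toFun := fun M => D * M * E
      map_zero' := by simp
      map_add' := fun A B => by simp [Matrix.mul_add, Matrix.add_mul] }
  have hφ : Continuous φ := by
    change Continuous fun M : Matrix (Fin a) (Fin a) ℝ => D * M * E
    exact (continuous_const.matrix_mul continuous_id).matrix_mul continuous_const
  have h3 := h2.map φ hφ
  -- The two series agree from the first power on; the zeroth term `D E` has to be corrected to `1`.
  have h4 := h3.add (hasSum_ite_eq (0 : ℕ) (1 - D * E))
  refine h1.unique (h4.congr_fun ?_)
  intro k
  rcases k with _ | k
  · simp [φ]
  · simp [φ, pow_dup_elim D E hED]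

lemma corrExp_eq (b σ : ℝ → ℝ) (ℓ : Kernel ℝ ℝ) (n r : ℕ) (τ : ℝ) :
    corrExp b σ ℓ n r τ = dupExpElim b σ ℓ n r τ + (1 - dupMatrix n r * elimMatrix n r) := by
  rw [corrExp, dupExpElim, ← exp_dup_elim _ _ (elimMatrix_mul_dupMatrix n r), corrGenerator]
  simp

/-- The tensor power lies in the range of `D`, on which the projection `D E` is the identity. -/
lemma corrExp_mulVec_vecPow (b σ : ℝ → ℝ) (ℓ : Kernel ℝ ℝ) (n r : ℕ) (τ x : ℝ) :
    corrExp b σ ℓ n r τ *ᵥ vecPow n r x = dupExpElim b σ ℓ n r τ *ᵥ vecPow n r x := by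
  rw [corrExp_eq, Matrix.add_mulVec, Matrix.sub_mulVec, ← Matrix.mulVec_mulVec,
    vecPow_eq_tensorMonomials, elimMatrix_mulVec, dupMatrix_mulVec, Matrix.one_mulVec, sub_self,
    add_zero]

lemma dupExpElim_mulVec (b σ : ℝ → ℝ) (ℓ : Kernel ℝ ℝ) (n r : ℕ) (τ x : ℝ) :
    dupExpElim b σ ℓ n r τ *ᵥ tensorMonomials n (r + 1) x = dupMatrix n r *ᵥ
      (NormedSpace.exp (τ • generatorMatrix b σ ℓ (n * (r + 1))) *ᵥ fun k => x ^ (k : ℕ)) := by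
  rw [dupExpElim, ← Matrix.mulVec_mulVec, ← Matrix.mulVec_mulVec, elimMatrix_mulVec]

lemma corrGenerator_zero (b σ : ℝ → ℝ) (ℓ : Kernel ℝ ℝ) (n : ℕ) :
    corrGenerator b σ ℓ n 0 = mcast (by simp) (by simp) (generatorMatrix b σ ℓ n) := by
  -- The order `n * (0 + 1)` is generalized to a variable `N`, so that the equation `N = n` can be
  -- eliminated despite the dependence of the matrix types on it.
  have key : ∀ N (hN : N = n) (h1 : n + 1 = N + 1) (h2 : n + 1 = (n + 1) ^ 1),
      mcast h2 h1 (1 : Matrix (Fin (n + 1)) (Fin (n + 1)) ℝ) * generatorMatrix b σ ℓ N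
        * mcast h1 h2 (1 : Matrix (Fin (n + 1)) (Fin (n + 1)) ℝ)
      = mcast h2 h2 (generatorMatrix b σ ℓ n) := by
    rintro N rfl h1 h2
    generalize generatorMatrix b σ ℓ N = G
    have : G = mcast rfl rfl G := rfl
    rw [this, mcast_mul_mcast h2 h1 h1, mcast_mul_mcast]
    simp; rfl
  exact key _ (by simp) _ _

/-! ### The matrices `I ⊗^r p` -/

lemma kronPow_one (a r : ℕ) : kronPow (1 : Matrix (Fin a) (Fin a) ℝ) r = 1 := by
  induction r with
  | zero => exact mcast_one _ _
  | succ r ih => rw [kronPow, ih, kron_one_one, mcast_one]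

lemma idKronCoeff_snocIdx (n r : ℕ) (p : ℝ[X]) (j : Fin ((n + 1) ^ r)) (i : Fin (n + 1))
    (k : Fin ((n + 1) ^ r)) :
    idKronCoeff n r p (snocIdx j i) k = if j = k then p.coeff i else 0 := by
  have h2 : (Fin.cast (by simp) k : Fin ((n + 1) ^ r * 1)) =
      finProdFinEquiv (k, (0 : Fin 1)) := by
    ext; simp
  simp only [idKronCoeff, mcast, Matrix.submatrix_apply, snocIdx, Fin.cast_cast, Fin.cast_refl, id,
    h2, dKron, kron_apply, kronPow_one, Matrix.one_apply, coeffCol, Matrix.of_apply]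
  split_ifs <;> simp

lemma vecMul_idKronCoeff (n r : ℕ) (p : ℝ[X]) (w : Fin ((n + 1) ^ (r + 1)) → ℝ)
    (k : Fin ((n + 1) ^ r)) :
    (w ᵥ* idKronCoeff n r p) k = ∑ i : Fin (n + 1), w (snocIdx k i) * p.coeff i := by
  simp only [Matrix.vecMul, dotProduct]
  rw [sum_snocIdx, Finset.sum_eq_single k]
  · simp [idKronCoeff_snocIdx]
  · intro j _ hj
    simp [idKronCoeff_snocIdx, hj]
  · simp

/-- Both sides contract the last tensor factor of `w` with the coefficients of `p`. So the leading
factor of the correlator formula is of the same kind as the factors `I ⊗^j p_j`. -/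
lemma coeffCol_mul_vecInv (n r : ℕ) (p : ℝ[X]) (w : Fin ((n + 1) ^ (r + 1)) → ℝ)
    (k : Fin ((n + 1) ^ r)) :
    ((coeffCol n p)ᵀ * vecInv (pow_succ (n + 1) r) w) 0 k = (w ᵥ* idKronCoeff n r p) k := by
  rw [vecMul_idKronCoeff, Matrix.mul_apply]
  refine Finset.sum_congr rfl fun i _ => ?_
  simp [coeffCol, vecInv, snocIdx, mul_comm]

lemma tensorMonomials_vecMul_idKronCoeff (n r : ℕ) (p : ℝ[X]) (hp : p.natDegree ≤ n) (x : ℝ) :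
    tensorMonomials n (r + 1) x ᵥ* idKronCoeff n r p = p.eval x • tensorMonomials n r x := by
  ext k
  rw [vecMul_idKronCoeff, Polynomial.eval_eq_sum_range' (Nat.lt_succ_of_le hp),
    Finset.sum_range, Pi.smul_apply, smul_eq_mul, Finset.sum_mul]
  refine Finset.sum_congr rfl fun i _ => ?_
  rw [tensorMonomials_snocIdx]; ring

/-! ### Polynomial growth -/

lemma one_le_one_add_sq (x : ℝ) : 1 ≤ 1 + x ^ 2 := by nlinarith [sq_nonneg x]

lemma abs_pow_le_one_add_sq_pow (x : ℝ) {i k : ℕ} (h : i ≤ 2 * k) :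
    |x| ^ i ≤ (1 + x ^ 2) ^ k := by
  refine (sq_le_sq₀ (by positivity) (by positivity)).1 ?_
  calc (|x| ^ i) ^ 2 = (x ^ 2) ^ i := by rw [← pow_mul, mul_comm, pow_mul, sq_abs]
    _ ≤ (1 + x ^ 2) ^ i := by gcongr; linarith
    _ ≤ (1 + x ^ 2) ^ (2 * k) := pow_le_pow_right₀ (one_le_one_add_sq x) h
    _ = ((1 + x ^ 2) ^ k) ^ 2 := by rw [← pow_mul, mul_comm]

lemma exists_abs_eval_le (q : ℝ[X]) {k : ℕ} (hq : q.natDegree ≤ 2 * k) :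
    ∃ C, 0 ≤ C ∧ ∀ x, |q.eval x| ≤ C * (1 + x ^ 2) ^ k := by
  refine ⟨∑ i ∈ Finset.range (2 * k + 1), |q.coeff i|, by positivity, fun x => ?_⟩
  rw [Polynomial.eval_eq_sum_range' (Nat.lt_succ_of_le hq), Finset.sum_mul]
  refine (Finset.abs_sum_le_sum_abs _ _).trans (Finset.sum_le_sum fun i hi => ?_)
  rw [abs_mul, abs_pow]
  gcongr
  exact abs_pow_le_one_add_sq_pow x (by simpa [Nat.lt_succ_iff] using hi)

lemma contDiff_one_deriv {f : ℝ → ℝ} (hf : ContDiff ℝ 2 f) : ContDiff ℝ 1 (deriv f) := by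
  have : ContDiff ℝ (1 + 1) f := by simpa [one_add_one_eq_two] using hf
  exact (contDiff_succ_iff_deriv.1 this).2.2

/-- First-order Taylor estimate. -/
lemma abs_taylor_remainder_le {f : ℝ → ℝ} (hf : ContDiff ℝ 2 f) {x z K : ℝ}
    (hK : ∀ u ∈ Set.uIcc x (x + z), |deriv (deriv f) u| ≤ K) :
    |f (x + z) - f x - deriv f x * z| ≤ K * z ^ 2 := by
  have hd : Differentiable ℝ f := hf.differentiable (by norm_num)
  have hf1 := contDiff_one_deriv hf
  have hdd : Differentiable ℝ (deriv f) := hf1.differentiable (by norm_num)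
  have hconv : Convex ℝ (Set.uIcc x (x + z)) := convex_uIcc _ _
  have hx : x ∈ Set.uIcc x (x + z) := Set.left_mem_uIcc
  have hxz : x + z ∈ Set.uIcc x (x + z) := Set.right_mem_uIcc
  have hK0 : 0 ≤ K := (abs_nonneg _).trans (hK x hx)
  have h1 : ∀ u ∈ Set.uIcc x (x + z), ‖deriv f u - deriv f x‖ ≤ K * |z| := by
    intro u hu
    have := hconv.norm_image_sub_le_of_norm_deriv_le (f := deriv f) (C := K)
      (fun v _ => hdd v) (fun v hv => hK v hv) hx hu
    refine this.trans ?_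
    gcongr
    have := Set.abs_sub_left_of_mem_uIcc hu
    rw [Real.norm_eq_abs]
    simpa using this
  have hg : ∀ v, HasDerivAt (fun u => f u - deriv f x * u) (deriv f v - deriv f x) v := by
    intro v
    have := (hd v).hasDerivAt.sub ((hasDerivAt_id v).const_mul (deriv f x))
    rw [mul_one] at this
    exact this
  have h2 := hconv.norm_image_sub_le_of_norm_hasDerivWithin_le
    (f := fun u => f u - deriv f x * u) (C := K * |z|)
    (fun v _ => (hg v).hasDerivWithinAt) h1 hx hxz
  simp only [Real.norm_eq_abs, add_sub_cancel_left] at h2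
  calc |f (x + z) - f x - deriv f x * z|
      = |f (x + z) - deriv f x * (x + z) - (f x - deriv f x * x)| := by ring_nf
    _ ≤ K * |z| * |z| := h2
    _ = K * z ^ 2 := by rw [mul_assoc, abs_mul_abs_self]; ring

/-! ### The generator on polynomials -/

variable {b σ : ℝ → ℝ} {ℓ : Kernel ℝ ℝ}

lemma IsPolynomialOperator.integrable_pow' (hpol : IsPolynomialOperator b σ ℓ) (x : ℝ) {k : ℕ}
    (hk : 2 ≤ k) : Integrable (fun z : ℝ => z ^ k) (ℓ x) := by
  refine (hpol.integrable_pow x k hk).mono' (by fun_prop) (ae_of_all _ fun z => ?_)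
  simp

lemma IsPolynomialOperator.integrable_sq_mul_eval (hpol : IsPolynomialOperator b σ ℓ) (x : ℝ)
    (r : ℝ[X]) : Integrable (fun z : ℝ => z ^ 2 * r.eval z) (ℓ x) := by
  simp_rw [Polynomial.eval_eq_sum_range, Finset.mul_sum]
  refine integrable_finsetSum _ fun i _ => ?_
  have := (hpol.integrable_pow' x (k := i + 2) (by omega)).const_mul (r.coeff i)
  refine this.congr (ae_of_all _ fun z => ?_)
  simp only
  ring

/-- Taylor expansion at `x`: the terms of order zero and one cancel. Only jump moments of order at
least two are then needed for integrability. -/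
lemma exists_increment_eq_sq_mul (p : ℝ[X]) (x : ℝ) :
    ∃ r : ℝ[X], ∀ z, p.eval (x + z) - p.eval x - p.derivative.eval x * z = z ^ 2 * r.eval z := by
  have : (Polynomial.X : ℝ[X]) ^ 2 ∣ p.taylor x - Polynomial.C (p.eval x)
      - Polynomial.C (p.derivative.eval x) * Polynomial.X := by
    rw [Polynomial.X_pow_dvd_iff]
    intro d hd
    interval_cases d
    · simp
    · simp [Polynomial.taylor_coeff_one]
  obtain ⟨r, hr⟩ := this
  refine ⟨r, fun z => ?_⟩
  have := congrArg (Polynomial.eval z) hr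
  simpa [Polynomial.taylor_eval, add_comm] using this

lemma IsPolynomialOperator.integrable_increment (hpol : IsPolynomialOperator b σ ℓ) (x : ℝ)
    (p : ℝ[X]) :
    Integrable (fun z : ℝ => p.eval (x + z) - p.eval x - p.derivative.eval x * z) (ℓ x) := by
  obtain ⟨r, hr⟩ := exists_increment_eq_sq_mul p x
  simp_rw [hr]
  exact hpol.integrable_sq_mul_eval x r

lemma generator_eval (p : ℝ[X]) (x : ℝ) :
    generator b σ ℓ (fun u => p.eval u) x = b x * p.derivative.eval x
      + 1 / 2 * σ x ^ 2 * p.derivative.derivative.eval x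
      + ∫ z, (p.eval (x + z) - p.eval x - p.derivative.eval x * z) ∂(ℓ x) := by
  have : deriv (fun u => p.eval u) = fun u => p.derivative.eval u := by
    ext u; exact p.deriv
  simp only [generator, this, Polynomial.deriv]

/-- The generator at a point as a linear functional on polynomials. -/
def IsPolynomialOperator.evalGenerator (hpol : IsPolynomialOperator b σ ℓ) (x : ℝ) :
    ℝ[X] →ₗ[ℝ] ℝ where
  toFun p := generator b σ ℓ (fun u => p.eval u) x
  map_add' p q := by
    have h := integral_add (hpol.integrable_increment x p) (hpol.integrable_increment x q)
    have h' : ∫ z, ((p + q).eval (x + z) - (p + q).eval x - (p + q).derivative.eval x * z) ∂(ℓ x)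
        = ∫ z, (p.eval (x + z) - p.eval x - p.derivative.eval x * z) ∂(ℓ x)
          + ∫ z, (q.eval (x + z) - q.eval x - q.derivative.eval x * z) ∂(ℓ x) := by
      rw [← h]
      congr 1; ext z
      simp only [Polynomial.eval_add, Polynomial.derivative_add]; ring
    rw [generator_eval, generator_eval, generator_eval, h']
    simp only [Polynomial.eval_add, Polynomial.derivative_add]; ring
  map_smul' c p := by
    have h' : ∫ z, ((c • p).eval (x + z) - (c • p).eval x - (c • p).derivative.eval x * z) ∂(ℓ x)
        = c * ∫ z, (p.eval (x + z) - p.eval x - p.derivative.eval x * z) ∂(ℓ x) := by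
      rw [← integral_const_mul]
      congr 1; ext z
      simp only [Polynomial.eval_smul, Polynomial.derivative_smul, smul_eq_mul]; ring
    rw [generator_eval, generator_eval, h']
    simp only [Polynomial.eval_smul, Polynomial.derivative_smul, smul_eq_mul, RingHom.id_apply]
    ring

/-- The generator of a power centred at the point of evaluation grows at most polynomially. -/
lemma IsPolynomialOperator.exists_generator_centered_pow_le
    (hpol : IsPolynomialOperator b σ ℓ) (k : ℕ) :
    ∃ C J, 0 ≤ C ∧ ∀ x, |generator b σ ℓ (fun u => (u - x) ^ k) x| ≤ C * (1 + x ^ 2) ^ J := by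
  choose q _ hq using fun i : ℕ => hpol.map_degree_le i (Polynomial.X ^ i) (by simp)
  -- Binomial expansion of `(u - x)^k` with `x` frozen, with each `u^i` replaced by the polynomial
  -- `q i` representing its image under `𝒢`; on the diagonal the result is a polynomial in `x`.
  let Q : ℝ[X] := ∑ i ∈ Finset.range (k + 1),
    (-Polynomial.X) ^ (k - i) * Polynomial.C (k.choose i : ℝ) * q i
  obtain ⟨C, hC, h⟩ := exists_abs_eval_le Q (k := Q.natDegree) (by omega)
  refine ⟨C, Q.natDegree, hC, fun x => ?_⟩
  convert h x
  have h1 : (fun u => (u - x) ^ k)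
      = fun u => ((Polynomial.X - Polynomial.C x : ℝ[X]) ^ k).eval u := by
    ext; simp
  have h2 : (Polynomial.X - Polynomial.C x : ℝ[X]) ^ k = ∑ i ∈ Finset.range (k + 1),
      ((-x) ^ (k - i) * (k.choose i : ℝ)) • (Polynomial.X : ℝ[X]) ^ i := by
    rw [sub_eq_add_neg, add_pow]
    refine Finset.sum_congr rfl fun i _ => ?_
    simp only [← Polynomial.C_neg, ← Polynomial.C_pow, ← Polynomial.C_eq_natCast,
      Polynomial.smul_eq_C_mul, Polynomial.C_mul]
    ring
  have h3 : generator b σ ℓ (fun u => (u - x) ^ k) x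
      = hpol.evalGenerator x ((Polynomial.X - Polynomial.C x : ℝ[X]) ^ k) := by
    rw [h1]; rfl
  rw [h3, h2, map_sum, Polynomial.eval_finsetSum]
  refine Finset.sum_congr rfl fun i _ => ?_
  rw [map_smul]
  change _ * generator b σ ℓ _ x = _
  rw [hq]
  simp

/-- The value and the first derivative of `(u - x)^k` vanish at `x`, and the second derivative
survives only for `k = 2`. This isolates the jump moments and `σ²`, both nonnegative for even `k`,
so each is bounded separately. -/
lemma generator_centered_pow {k : ℕ} (hk : 2 ≤ k) (x : ℝ) :
    generator b σ ℓ (fun u => (u - x) ^ k) x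
      = (if k = 2 then σ x ^ 2 else 0) + ∫ z, z ^ k ∂(ℓ x) := by
  have hd : ∀ j : ℕ, deriv (fun u => (u - x) ^ j) = fun u => j * (u - x) ^ (j - 1) := by
    intro j; ext u
    simp
  have hdd : deriv (fun u => (k : ℝ) * (u - x) ^ (k - 1)) x = k * ((k - 1 : ℕ) * 0 ^ (k - 1 - 1)) := by
    rw [deriv_const_mul_field, hd]; simp
  simp only [generator, hd, hdd]
  have e1 : k - 1 ≠ 0 := by omega
  have e0 : k ≠ 0 := by omega
  split_ifs with h
  · subst h; norm_num; ring
  · have e2 : k - 1 - 1 ≠ 0 := by omega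
    simp [e0, e1, e2]

lemma IsPolynomialOperator.exists_integral_pow_le (hpol : IsPolynomialOperator b σ ℓ) (k : ℕ)
    (hk : 1 ≤ k) :
    ∃ C J, 0 ≤ C ∧ ∀ x, ∫ z, z ^ (2 * k) ∂(ℓ x) ≤ C * (1 + x ^ 2) ^ J := by
  obtain ⟨C, J, hC, h⟩ := hpol.exists_generator_centered_pow_le (2 * k)
  refine ⟨C, J, hC, fun x => le_trans ?_ ((le_abs_self _).trans (h x))⟩
  rw [generator_centered_pow (by omega)]
  have : 0 ≤ if 2 * k = 2 then σ x ^ 2 else 0 := by split_ifs <;> positivity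
  linarith

lemma IsPolynomialOperator.exists_diffusion_le (hpol : IsPolynomialOperator b σ ℓ) :
    ∃ C J, 0 ≤ C ∧ ∀ x, σ x ^ 2 ≤ C * (1 + x ^ 2) ^ J := by
  obtain ⟨C, J, hC, h⟩ := hpol.exists_generator_centered_pow_le 2
  refine ⟨C, J, hC, fun x => le_trans ?_ ((le_abs_self _).trans (h x))⟩
  rw [generator_centered_pow le_rfl, if_pos rfl]
  have : 0 ≤ ∫ z, z ^ 2 ∂(ℓ x) := integral_nonneg fun z => by positivity
  linarith

lemma IsPolynomialOperator.exists_drift_le (hpol : IsPolynomialOperator b σ ℓ) :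
    ∃ C J, 0 ≤ C ∧ ∀ x, |b x| ≤ C * (1 + x ^ 2) ^ J := by
  -- For the identity function the second-order term and the jump integrand vanish, so its image
  -- under `𝒢` is `b` itself.
  obtain ⟨q, hq, h⟩ := hpol.map_degree_le 1 Polynomial.X (by simp)
  obtain ⟨C, hC, hb⟩ := exists_abs_eval_le q (k := 1) (by omega)
  refine ⟨C, 1, hC, fun x => ?_⟩
  have := h x
  rw [generator_eval] at this
  simp at this
  rw [this]; exact hb x

lemma one_add_pow_le {a : ℝ} (ha : 0 ≤ a) (j : ℕ) : (1 + a) ^ j ≤ 2 ^ j * (1 + a ^ j) := by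
  calc (1 + a) ^ j ≤ 2 ^ (j - 1) * (1 ^ j + a ^ j) := add_pow_le zero_le_one ha j
    _ ≤ 2 ^ j * (1 + a ^ j) := by
      rw [one_pow]; gcongr <;> norm_num

lemma IsPolynomialOperator.integrable_weight (hpol : IsPolynomialOperator b σ ℓ) (j : ℕ) (x : ℝ) :
    Integrable (fun z : ℝ => z ^ 2 * (1 + z ^ 2) ^ j) (ℓ x) := by
  have := hpol.integrable_sq_mul_eval x ((1 + Polynomial.X ^ 2) ^ j)
  simpa using this

lemma IsPolynomialOperator.exists_integral_weight_le (hpol : IsPolynomialOperator b σ ℓ) (j : ℕ) :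
    ∃ C J, 0 ≤ C ∧ ∀ x, ∫ z, z ^ 2 * (1 + z ^ 2) ^ j ∂(ℓ x) ≤ C * (1 + x ^ 2) ^ J := by
  obtain ⟨C₁, J₁, hC₁, h₁⟩ := hpol.exists_integral_pow_le 1 le_rfl
  obtain ⟨C₂, J₂, hC₂, h₂⟩ := hpol.exists_integral_pow_le (j + 1) (by omega)
  refine ⟨2 ^ j * (C₁ + C₂), J₁ + J₂, by positivity, fun x => ?_⟩
  have i₁ := hpol.integrable_pow' x (k := 2 * 1) (by omega)
  have i₂ := hpol.integrable_pow' x (k := 2 * (j + 1)) (by omega)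
  calc ∫ z, z ^ 2 * (1 + z ^ 2) ^ j ∂(ℓ x)
      ≤ ∫ z, 2 ^ j * (z ^ (2 * 1) + z ^ (2 * (j + 1))) ∂(ℓ x) := by
        refine integral_mono (hpol.integrable_weight j x) ((i₁.add i₂).const_mul _) fun z => ?_
        calc z ^ 2 * (1 + z ^ 2) ^ j ≤ z ^ 2 * (2 ^ j * (1 + (z ^ 2) ^ j)) := by
              gcongr; exact one_add_pow_le (sq_nonneg z) j
          _ = 2 ^ j * (z ^ (2 * 1) + z ^ (2 * (j + 1))) := by ring
    _ = 2 ^ j * (∫ z, z ^ (2 * 1) ∂(ℓ x) + ∫ z, z ^ (2 * (j + 1)) ∂(ℓ x)) := by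
        rw [integral_const_mul, integral_add i₁ i₂]
    _ ≤ 2 ^ j * (C₁ * (1 + x ^ 2) ^ (J₁ + J₂) + C₂ * (1 + x ^ 2) ^ (J₁ + J₂)) := by
        gcongr
        · refine (h₁ x).trans ?_
          gcongr
          · exact one_le_one_add_sq x
          · omega
        · refine (h₂ x).trans ?_
          gcongr
          · exact one_le_one_add_sq x
          · omega
    _ = _ := by ring

/-- Pointwise domination of the jump integrand of a function of polynomial growth. -/
lemma abs_increment_le {f : ℝ → ℝ} (hf : ContDiff ℝ 2 f) {K : ℝ} {j : ℕ} (hK : 0 ≤ K)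
    (h2 : ∀ x, |deriv (deriv f) x| ≤ K * (1 + x ^ 2) ^ j) (x z : ℝ) :
    |f (x + z) - f x - deriv f x * z|
      ≤ K * (2 ^ j * (1 + x ^ 2) ^ j) * (z ^ 2 * (1 + z ^ 2) ^ j) := by
  have := abs_taylor_remainder_le hf (x := x) (z := z)
    (K := K * (2 ^ j * (1 + x ^ 2) ^ j * (1 + z ^ 2) ^ j)) (fun u hu => ?_)
  · refine this.trans (le_of_eq (by ring))
  · refine (h2 u).trans ?_
    -- It remains to show `1 + u² ≤ 2(1 + x²)(1 + z²)`, which follows from `|u - x| ≤ |z|`.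
    rw [← mul_pow, ← mul_pow]
    gcongr
    have h := Set.abs_sub_left_of_mem_uIcc hu
    have h' : (u - x) ^ 2 ≤ z ^ 2 := by
      apply sq_le_sq.2; simpa using h
    nlinarith [sq_nonneg (u - 2 * x), sq_nonneg (x * z)]

lemma IsPolynomialOperator.integrable_of_growth (hpol : IsPolynomialOperator b σ ℓ) {f : ℝ → ℝ}
    (hf : ContDiff ℝ 2 f) {K : ℝ} {j : ℕ} (hK : 0 ≤ K)
    (h2 : ∀ x, |deriv (deriv f) x| ≤ K * (1 + x ^ 2) ^ j) (x : ℝ) :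
    Integrable (fun z => f (x + z) - f x - deriv f x * z) (ℓ x) := by
  have hc := hf.continuous
  refine ((hpol.integrable_weight j x).const_mul _).mono' (by fun_prop)
    (ae_of_all _ fun z => abs_increment_le hf hK h2 x z)

/-- The constants are chosen before `f` and depend only on the growth exponent `j`; this gives a
single majorant for the whole family of truncated monomials. -/
lemma IsPolynomialOperator.exists_generator_le_of_growth (hpol : IsPolynomialOperator b σ ℓ)
    (j : ℕ) : ∃ C J, 0 ≤ C ∧ ∀ (f : ℝ → ℝ) (K : ℝ), ContDiff ℝ 2 f → 0 ≤ K →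
      (∀ x, |deriv f x| ≤ K * (1 + x ^ 2) ^ j) →
      (∀ x, |deriv (deriv f) x| ≤ K * (1 + x ^ 2) ^ j) →
      ∀ x, |generator b σ ℓ f x| ≤ K * C * (1 + x ^ 2) ^ J := by
  obtain ⟨C₁, J₁, hC₁, hb⟩ := hpol.exists_drift_le
  obtain ⟨C₂, J₂, hC₂, hσ⟩ := hpol.exists_diffusion_le
  obtain ⟨C₃, J₃, hC₃, hℓ⟩ := hpol.exists_integral_weight_le j
  refine ⟨C₁ + C₂ + 2 ^ j * C₃, j + J₁ + J₂ + J₃, by positivity, fun f K hf hK h1 h2 x => ?_⟩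
  have hw := one_le_one_add_sq x
  have e1 : |b x * deriv f x| ≤ K * C₁ * (1 + x ^ 2) ^ (j + J₁ + J₂ + J₃) := by
    rw [abs_mul]
    calc |b x| * |deriv f x| ≤ (C₁ * (1 + x ^ 2) ^ J₁) * (K * (1 + x ^ 2) ^ j) := by
          gcongr; exacts [hb x, h1 x]
      _ = K * C₁ * (1 + x ^ 2) ^ (j + J₁) := by ring
      _ ≤ _ := by refine mul_le_mul_of_nonneg_left ?_ (by positivity); exact pow_le_pow_right₀ hw (by omega)
  have e2 : |1 / 2 * σ x ^ 2 * deriv (deriv f) x| ≤ K * C₂ * (1 + x ^ 2) ^ (j + J₁ + J₂ + J₃) := by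
    rw [abs_mul, abs_of_nonneg (by positivity : 0 ≤ 1 / 2 * σ x ^ 2)]
    calc 1 / 2 * σ x ^ 2 * |deriv (deriv f) x|
        ≤ (1 * (C₂ * (1 + x ^ 2) ^ J₂)) * (K * (1 + x ^ 2) ^ j) := by
          gcongr
          · norm_num
          · exact hσ x
          · exact h2 x
      _ = K * C₂ * (1 + x ^ 2) ^ (j + J₂) := by ring
      _ ≤ _ := by refine mul_le_mul_of_nonneg_left ?_ (by positivity); exact pow_le_pow_right₀ hw (by omega)
  have e3 : |∫ z, (f (x + z) - f x - deriv f x * z) ∂(ℓ x)|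
      ≤ K * (2 ^ j * C₃) * (1 + x ^ 2) ^ (j + J₁ + J₂ + J₃) := by
    calc |∫ z, (f (x + z) - f x - deriv f x * z) ∂(ℓ x)|
        ≤ ∫ z, K * (2 ^ j * (1 + x ^ 2) ^ j) * (z ^ 2 * (1 + z ^ 2) ^ j) ∂(ℓ x) := by
          rw [← Real.norm_eq_abs]
          exact norm_integral_le_of_norm_le ((hpol.integrable_weight j x).const_mul _)
            (ae_of_all _ fun z => abs_increment_le hf hK h2 x z)
      _ = K * (2 ^ j * (1 + x ^ 2) ^ j) * ∫ z, z ^ 2 * (1 + z ^ 2) ^ j ∂(ℓ x) :=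
          integral_const_mul _ _
      _ ≤ K * (2 ^ j * (1 + x ^ 2) ^ j) * (C₃ * (1 + x ^ 2) ^ J₃) := by
          gcongr; exact hℓ x
      _ = K * (2 ^ j * C₃) * (1 + x ^ 2) ^ (j + J₃) := by ring
      _ ≤ _ := by refine mul_le_mul_of_nonneg_left ?_ (by positivity); exact pow_le_pow_right₀ hw (by omega)
  calc |generator b σ ℓ f x| ≤ _ := abs_add_three _ _ _
    _ ≤ _ := add_le_add_three e1 e2 e3
    _ = _ := by ring

/-- For bounded `C²` functions the jump integrand is locally uniformly dominated by `z²`. -/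
lemma exists_abs_increment_le_sq {f : ℝ → ℝ} (hf : ContDiff ℝ 2 f) {B : ℝ}
    (hB : ∀ x, |f x| ≤ B) (R : ℝ) :
    ∃ K, 0 ≤ K ∧ ∀ x, |x| ≤ R → |deriv f x| ≤ K ∧ |deriv (deriv f) x| ≤ K ∧
      ∀ z, |f (x + z) - f x - deriv f x * z| ≤ K * z ^ 2 := by
  have hf1 := contDiff_one_deriv hf
  have hf2 : Continuous (deriv (deriv f)) := hf1.continuous_deriv le_rfl
  obtain ⟨K₁, hK₁⟩ := (isCompact_Icc (a := -(R + 1)) (b := R + 1)).exists_bound_of_continuousOn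
    hf1.continuous.continuousOn
  obtain ⟨K₂, hK₂⟩ := (isCompact_Icc (a := -(R + 1)) (b := R + 1)).exists_bound_of_continuousOn
    hf2.continuousOn
  have hB0 : 0 ≤ B := (abs_nonneg _).trans (hB 0)
  refine ⟨|K₁| + |K₂| + 2 * B, by positivity, fun x hx => ?_⟩
  have hx' := abs_le.1 hx
  have hxm : x ∈ Set.Icc (-(R + 1)) (R + 1) := ⟨by linarith, by linarith⟩
  have h1 : |deriv f x| ≤ |K₁| := (hK₁ x hxm).trans (le_abs_self _)
  have h2 : |deriv (deriv f) x| ≤ |K₂| := (hK₂ x hxm).trans (le_abs_self _)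
  have p1 := abs_nonneg K₁
  have p2 := abs_nonneg K₂
  refine ⟨by linarith, by linarith, fun z => ?_⟩
  -- Small jumps stay in the compact interval of radius `R + 1`, where Taylor's estimate applies;
  -- for large jumps both `1` and `|z|` are at most `z²`.
  by_cases hz : |z| ≤ 1
  · refine abs_taylor_remainder_le hf fun u hu => ?_
    have h := Set.abs_sub_left_of_mem_uIcc hu
    rw [add_sub_cancel_left] at h
    have hu' := abs_le.1 (h.trans hz)
    have : |deriv (deriv f) u| ≤ |K₂| :=
      (hK₂ u ⟨by linarith, by linarith⟩).trans (le_abs_self _)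
    linarith
  · push Not at hz
    have hz2 : |z| ≤ z ^ 2 := by rw [← sq_abs]; nlinarith
    have a1 := hB (x + z)
    have a2 := hB x
    calc |f (x + z) - f x - deriv f x * z| ≤ |f (x + z)| + |f x| + |deriv f x| * |z| := by
          rw [← abs_mul]
          exact (abs_sub _ _).trans (by gcongr; exact abs_sub _ _)
      _ ≤ B * z ^ 2 + B * z ^ 2 + |K₁| * z ^ 2 := by
          gcongr <;> nlinarith
      _ ≤ _ := by nlinarith [mul_nonneg p2 (sq_nonneg z)]

lemma IsPolynomialOperator.integrable_of_bounded (hpol : IsPolynomialOperator b σ ℓ) {f : ℝ → ℝ}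
    (hf : ContDiff ℝ 2 f) {B : ℝ} (hB : ∀ x, |f x| ≤ B) (x : ℝ) :
    Integrable (fun z => f (x + z) - f x - deriv f x * z) (ℓ x) := by
  have hc := hf.continuous
  obtain ⟨K, -, h⟩ := exists_abs_increment_le_sq hf hB |x|
  refine ((hpol.integrable_pow' x le_rfl).const_mul K).mono' (by fun_prop)
    (ae_of_all _ fun z => (h x le_rfl).2.2 z)

lemma IsPolynomialOperator.exists_generator_le_of_bounded (hpol : IsPolynomialOperator b σ ℓ)
    {f : ℝ → ℝ} (hf : ContDiff ℝ 2 f) {B : ℝ} (hB : ∀ x, |f x| ≤ B) (R : ℝ) :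
    ∃ C, ∀ x, |x| ≤ R → |generator b σ ℓ f x| ≤ C := by
  obtain ⟨K, hK, h⟩ := exists_abs_increment_le_sq hf hB R
  obtain ⟨C₁, J₁, hC₁, hb⟩ := hpol.exists_drift_le
  obtain ⟨C₂, J₂, hC₂, hσ⟩ := hpol.exists_diffusion_le
  obtain ⟨C₃, J₃, hC₃, hℓ⟩ := hpol.exists_integral_pow_le 1 le_rfl
  refine ⟨C₁ * (1 + R ^ 2) ^ J₁ * K + 1 / 2 * (C₂ * (1 + R ^ 2) ^ J₂) * K
    + K * (C₃ * (1 + R ^ 2) ^ J₃), fun x hx => ?_⟩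
  obtain ⟨h1, h2, h3⟩ := h x hx
  have hR : x ^ 2 ≤ R ^ 2 := sq_le_sq.2 (hx.trans (le_abs_self R))
  refine (abs_add_three _ _ _).trans (add_le_add_three ?_ ?_ ?_)
  · rw [abs_mul]
    gcongr
    exact (hb x).trans (by gcongr)
  · rw [abs_mul, abs_of_nonneg (by positivity : 0 ≤ 1 / 2 * σ x ^ 2)]
    gcongr
    exact (hσ x).trans (by gcongr)
  · calc |∫ z, (f (x + z) - f x - deriv f x * z) ∂(ℓ x)|
        ≤ ∫ z, K * z ^ 2 ∂(ℓ x) := by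
          rw [← Real.norm_eq_abs]
          exact norm_integral_le_of_norm_le ((hpol.integrable_pow' x le_rfl).const_mul _)
            (ae_of_all _ h3)
      _ = K * ∫ z, z ^ 2 ∂(ℓ x) := integral_const_mul _ _
      _ ≤ _ := by gcongr; exact (hℓ x).trans (by gcongr)

/-! ### Measurability of the generator -/

lemma IsPolynomialOperator.exists_lintegral_sq_le (hpol : IsPolynomialOperator b σ ℓ) :
    ∃ C J, 0 ≤ C ∧ ∀ x, ∫⁻ z, ((Real.toNNReal (z ^ 2) : ℝ≥0) : ENNReal) ∂(ℓ x)
      ≤ ENNReal.ofReal (C * (1 + x ^ 2) ^ J) := by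
  obtain ⟨C, J, hC, h⟩ := hpol.exists_integral_pow_le 1 le_rfl
  refine ⟨C, J, hC, fun x => ?_⟩
  calc ∫⁻ z, ((Real.toNNReal (z ^ 2) : ℝ≥0) : ENNReal) ∂(ℓ x)
      = ENNReal.ofReal (∫ z, z ^ 2 ∂(ℓ x)) :=
        (ofReal_integral_eq_lintegral_ofReal (hpol.integrable_pow' x le_rfl)
          (ae_of_all _ fun z => sq_nonneg z)).symm
    _ ≤ _ := ENNReal.ofReal_le_ofReal (h x)

/-- The kernel `(1 + x²)^{-J} z² ℓ(x, dz)`. -/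
def weightedKernel (ℓ : Kernel ℝ ℝ) (J : ℕ) : Kernel ℝ ℝ where
  toFun x := ENNReal.ofReal (((1 + x ^ 2) ^ J)⁻¹) •
    (ℓ x).withDensity (fun z => ((Real.toNNReal (z ^ 2) : ℝ≥0) : ENNReal))
  measurable' := by
    refine Measure.measurable_of_measurable_coe _ fun s hs => ?_
    simp only [Measure.smul_apply, withDensity_apply _ hs, smul_eq_mul]
    refine Measurable.mul (by fun_prop) ?_
    simp_rw [← lintegral_indicator hs]
    exact Measurable.lintegral_kernel (Measurable.indicator (by fun_prop) hs)

lemma weightedKernel_apply (J : ℕ) (x : ℝ) :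
    weightedKernel ℓ J x = ENNReal.ofReal (((1 + x ^ 2) ^ J)⁻¹) •
      (ℓ x).withDensity (fun z => ((Real.toNNReal (z ^ 2) : ℝ≥0) : ENNReal)) := rfl

/-- The measures `ℓ x` may have infinite mass near zero. The factor `z²` makes them finite and the
power of `1 + x²` makes the bound uniform in `x`, so that measurability of parameter integrals
against finite kernels becomes available. -/
lemma IsPolynomialOperator.exists_isFiniteKernel (hpol : IsPolynomialOperator b σ ℓ) :
    ∃ J, IsFiniteKernel (weightedKernel ℓ J) := by
  obtain ⟨C, J, hC, h⟩ := hpol.exists_lintegral_sq_le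
  refine ⟨J, ⟨ENNReal.ofReal C, by simp, fun x => ?_⟩⟩
  rw [weightedKernel_apply, Measure.smul_apply, withDensity_apply _ MeasurableSet.univ,
    setLIntegral_univ, smul_eq_mul]
  refine (mul_le_mul_right (h x) _).trans ?_
  rw [← ENNReal.ofReal_mul (by positivity)]
  refine ENNReal.ofReal_le_ofReal (le_of_eq ?_)
  field_simp

/-- The weight `z²` cancels against the denominator away from zero; at zero both integrands vanish
because `F 0 = 0`. -/
lemma integral_eq_weightedKernel (J : ℕ) (x : ℝ) (F : ℝ → ℝ) (hF : F 0 = 0) :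
    ∫ z, F z ∂(ℓ x) = (1 + x ^ 2) ^ J * ∫ z, F z / z ^ 2 ∂(weightedKernel ℓ J x) := by
  rw [weightedKernel_apply, integral_smul_measure,
    integral_withDensity_eq_integral_smul (by fun_prop), ENNReal.toReal_ofReal (by positivity),
    smul_eq_mul, ← mul_assoc, mul_inv_cancel₀ (by positivity), one_mul]
  congr 1; ext z
  by_cases hz : z = 0
  · simp [hz, hF]
  · rw [NNReal.smul_def, Real.coe_toNNReal _ (sq_nonneg z), smul_eq_mul]
    field_simp

lemma IsPolynomialOperator.measurable_generator (hop : IsJumpDiffusionOperator b σ ℓ)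
    (hpol : IsPolynomialOperator b σ ℓ) {f : ℝ → ℝ} (hf : Continuous f) :
    Measurable (generator b σ ℓ f) := by
  obtain ⟨J, hJ⟩ := hpol.exists_isFiniteKernel
  have hb := hop.measurable_b
  have hσ := hop.measurable_σ
  have hd : Measurable (deriv f) := measurable_deriv f
  have hdd : Measurable (deriv (deriv f)) := measurable_deriv _
  have hfm := hf.measurable
  have key : ∀ x, ∫ z, (f (x + z) - f x - deriv f x * z) ∂(ℓ x) = (1 + x ^ 2) ^ J *
      ∫ z, (f (x + z) - f x - deriv f x * z) / z ^ 2 ∂(weightedKernel ℓ J x) := by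
    intro x
    exact integral_eq_weightedKernel J x _ (by simp)
  have hm : StronglyMeasurable (fun q : ℝ × ℝ =>
      (f (q.1 + q.2) - f q.1 - deriv f q.1 * q.2) / q.2 ^ 2) := by
    apply Measurable.stronglyMeasurable
    fun_prop
  have := (hm.integral_kernel_prod_right' (κ := weightedKernel ℓ J)).measurable
  unfold generator
  simp_rw [key]
  refine Measurable.add (by fun_prop) (Measurable.mul (by fun_prop) this)

/-! ### Generator matrices -/

lemma IsPolynomialOperator.isGeneratorMatrix (hpol : IsPolynomialOperator b σ ℓ) (k : ℕ) :
    IsGeneratorMatrix b σ ℓ k (generatorMatrix b σ ℓ k) := by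
  have hex : ∃ M, IsGeneratorMatrix b σ ℓ k M := by
    choose q hq h using fun i : ℕ => hpol.map_degree_le i (Polynomial.X ^ i) (by simp)
    refine ⟨Matrix.of fun i j => (q i).coeff j, fun x => ?_⟩
    ext i l
    have hx := h i x
    simp only [Polynomial.eval_pow, Polynomial.eval_X] at hx
    rw [Matrix.of_apply, hx, Matrix.mul_apply, Polynomial.eval_eq_sum_range' (n := k + 1)
      (by have := hq i; have := i.2; omega), Finset.sum_range]
    simp [monomials]
  rw [generatorMatrix, dif_pos hex]
  exact hex.choose_spec

lemma IsPolynomialOperator.generator_pow (hpol : IsPolynomialOperator b σ ℓ) (k : ℕ)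
    (i : Fin (k + 1)) (x : ℝ) :
    generator b σ ℓ (fun u => u ^ (i : ℕ)) x
      = ∑ j, generatorMatrix b σ ℓ k i j * x ^ (j : ℕ) := by
  have := congrFun (congrFun (hpol.isGeneratorMatrix k x) i) 0
  simpa [Matrix.mul_apply, monomials] using this

/-! ### Lyapunov functions -/

/-- Concavity of `v ↦ v/(1 + εv)`: the graph lies below its tangents. Applied with `v = V(x)` and `w
= V(x + z)` it controls the jump part of the generator of the truncation. -/
lemma div_one_add_mul_le_tangent {ε v w : ℝ} (hε : 0 < ε) (hv : 0 ≤ v) (hw : 0 ≤ w) :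
    w / (1 + ε * w) - v / (1 + ε * v) ≤ (w - v) / (1 + ε * v) ^ 2 := by
  have h1 : 0 < 1 + ε * v := by positivity
  have h2 : 0 < 1 + ε * w := by positivity
  have : (w - v) / (1 + ε * v) ^ 2 - (w / (1 + ε * w) - v / (1 + ε * v))
      = ε * (w - v) ^ 2 / ((1 + ε * v) ^ 2 * (1 + ε * w)) := by
    field_simp; ring
  have h3 : 0 ≤ ε * (w - v) ^ 2 / ((1 + ε * v) ^ 2 * (1 + ε * w)) := by positivity
  linarith

/-- The truncation `V / (1 + εV)` of a polynomial. -/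
def truncPoly (V : ℝ[X]) (ε x : ℝ) : ℝ := V.eval x / (1 + ε * V.eval x)

lemma contDiff_truncPoly {V : ℝ[X]} (hV : ∀ x, 0 ≤ V.eval x) {ε : ℝ} (hε : 0 < ε) :
    ContDiff ℝ 2 (truncPoly V ε) := by
  have h : ContDiff ℝ 2 (fun x => V.eval x) := by
    simpa using V.contDiff_aeval (𝕜 := ℝ) 2
  refine h.div (contDiff_const.add (contDiff_const.mul h)) fun x => ?_
  have := hV x
  positivity

lemma truncPoly_nonneg {V : ℝ[X]} (hV : ∀ x, 0 ≤ V.eval x) {ε : ℝ} (hε : 0 < ε) (x : ℝ) :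
    0 ≤ truncPoly V ε x := by
  have := hV x
  unfold truncPoly
  positivity

lemma truncPoly_le {V : ℝ[X]} (hV : ∀ x, 0 ≤ V.eval x) {ε : ℝ} (hε : 0 < ε) (x : ℝ) :
    truncPoly V ε x ≤ V.eval x := by
  have := hV x
  exact div_le_self this (by nlinarith [mul_nonneg hε.le this])

lemma abs_truncPoly_le {V : ℝ[X]} (hV : ∀ x, 0 ≤ V.eval x) {ε : ℝ} (hε : 0 < ε) (x : ℝ) :
    |truncPoly V ε x| ≤ 1 / ε := by
  rw [abs_of_nonneg (truncPoly_nonneg hV hε x)]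
  have := hV x
  unfold truncPoly
  rw [div_le_div_iff₀ (by positivity) hε]
  nlinarith

lemma deriv_truncPoly {V : ℝ[X]} (hV : ∀ x, 0 ≤ V.eval x) {ε : ℝ} (hε : 0 < ε) :
    deriv (truncPoly V ε) = fun x => V.derivative.eval x / (1 + ε * V.eval x) ^ 2 := by
  ext x
  have hx : 1 + ε * V.eval x ≠ 0 := by have := hV x; positivity
  have h := (V.hasDerivAt x).div (((V.hasDerivAt x).const_mul ε).const_add 1) hx
  refine h.deriv.trans ?_
  congr 1; ring

/-- The discarded term `-2ε V'² / (1 + εV)³` is the contribution of the concavity of the truncation,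
hence nonpositive. -/
lemma deriv_deriv_truncPoly_le {V : ℝ[X]} (hV : ∀ x, 0 ≤ V.eval x) {ε : ℝ} (hε : 0 < ε) (x : ℝ) :
    deriv (deriv (truncPoly V ε)) x
      ≤ V.derivative.derivative.eval x / (1 + ε * V.eval x) ^ 2 := by
  rw [deriv_truncPoly hV hε]
  have hx0 : 0 < 1 + ε * V.eval x := by have := hV x; positivity
  have hx : (1 + ε * V.eval x) ^ 2 ≠ 0 := by positivity
  have h := (V.derivative.hasDerivAt x).div
    ((((V.hasDerivAt x).const_mul ε).const_add 1).pow 2) hx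
  have h' : deriv (fun x => V.derivative.eval x / (1 + ε * V.eval x) ^ 2) x = _ := h.deriv
  rw [h']
  simp only [Pi.pow_apply, Nat.cast_ofNat, Nat.add_one_sub_one, pow_one]
  rw [div_le_div_iff₀ (by positivity) (by positivity)]
  have e : 0 ≤ V.derivative.eval x ^ 2 * (2 * ε) * (1 + ε * V.eval x) ^ 3 := by positivity
  nlinarith

/-- The generator of the truncation of a nonnegative polynomial. -/
lemma IsPolynomialOperator.generator_truncPoly_le (hpol : IsPolynomialOperator b σ ℓ) {V : ℝ[X]}
    (hV : ∀ x, 0 ≤ V.eval x) {C : ℝ} (hC : 0 ≤ C)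
    (hVC : ∀ x, generator b σ ℓ (fun u => V.eval u) x ≤ C * V.eval x) {ε : ℝ} (hε : 0 < ε)
    (x : ℝ) : generator b σ ℓ (truncPoly V ε) x ≤ C * truncPoly V ε x := by
  have hx := hV x
  have hx0 : 1 ≤ 1 + ε * V.eval x := by nlinarith [mul_nonneg hε.le hx]
  have hx1 : 0 < 1 + ε * V.eval x := by positivity
  set a := ((1 + ε * V.eval x) ^ 2)⁻¹ with ha
  have ha0 : 0 ≤ a := by positivity
  have step : generator b σ ℓ (truncPoly V ε) x
      ≤ a * generator b σ ℓ (fun u => V.eval u) x := by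
    rw [generator_eval, mul_add, mul_add, ← integral_const_mul]
    unfold generator
    refine add_le_add_three (le_of_eq ?_) ?_ ?_
    · rw [deriv_truncPoly hV hε]; simp only [ha]; ring
    · have := deriv_deriv_truncPoly_le hV hε x
      have h2 : 0 ≤ 1 / 2 * σ x ^ 2 := by positivity
      calc _ ≤ 1 / 2 * σ x ^ 2 * _ := mul_le_mul_of_nonneg_left this h2
        _ = _ := by rw [ha]; ring
    · refine integral_mono (hpol.integrable_of_bounded (contDiff_truncPoly hV hε)
        (abs_truncPoly_le hV hε) x) ((hpol.integrable_increment x V).const_mul a) fun z => ?_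
      have := div_one_add_mul_le_tangent hε hx (hV (x + z))
      simp only [deriv_truncPoly hV hε, truncPoly]
      rw [div_eq_mul_inv _ ((1 + ε * V.eval x) ^ 2), ← ha] at this ⊢
      linarith
  refine step.trans ((mul_le_mul_of_nonneg_left (hVC x) ha0).trans ?_)
  rw [mul_left_comm]
  refine mul_le_mul_of_nonneg_left ?_ hC
  rw [truncPoly, ha, inv_mul_eq_div]
  exact div_le_div_of_nonneg_left hx hx1 (by nlinarith)

/-! ### Bounded approximations of monomials -/

/-- `sin(εx)/ε`. -/
def sinTrunc (ε x : ℝ) : ℝ := Real.sin (ε * x) / ε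

lemma abs_sinTrunc_le {ε : ℝ} (hε : 0 < ε) (x : ℝ) : |sinTrunc ε x| ≤ |x| := by
  rw [sinTrunc, abs_div, abs_of_pos hε, div_le_iff₀ hε]
  calc |Real.sin (ε * x)| ≤ |ε * x| := Real.abs_sin_le_abs
    _ = |x| * ε := by rw [abs_mul, abs_of_pos hε, mul_comm]

lemma abs_sinTrunc_pow_le {ε : ℝ} (hε : 0 < ε) (k : ℕ) (x : ℝ) :
    |sinTrunc ε x ^ k| ≤ (1 / ε) ^ k := by
  rw [abs_pow]
  gcongr
  rw [sinTrunc, abs_div, abs_of_pos hε]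
  gcongr
  exact Real.abs_sin_le_one _

lemma hasDerivAt_sinTrunc {ε : ℝ} (hε : 0 < ε) (x : ℝ) :
    HasDerivAt (sinTrunc ε) (Real.cos (ε * x)) x := by
  have := (((hasDerivAt_id x).const_mul ε).sin).div_const ε
  rw [mul_one, mul_div_assoc, div_self hε.ne', mul_one] at this
  exact this

lemma contDiff_sinTrunc_pow (ε : ℝ) (k : ℕ) : ContDiff ℝ 2 (fun x => sinTrunc ε x ^ k) := by
  unfold sinTrunc
  fun_prop

lemma deriv_sinTrunc_pow {ε : ℝ} (hε : 0 < ε) (k : ℕ) :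
    deriv (fun x => sinTrunc ε x ^ k)
      = fun x => k * sinTrunc ε x ^ (k - 1) * Real.cos (ε * x) := by
  ext x
  exact ((hasDerivAt_sinTrunc hε x).fun_pow k).deriv

lemma deriv_deriv_sinTrunc_pow {ε : ℝ} (hε : 0 < ε) (k : ℕ) (x : ℝ) :
    deriv (deriv (fun x => sinTrunc ε x ^ k)) x
      = k * ((k - 1 : ℕ) * sinTrunc ε x ^ (k - 1 - 1) * Real.cos (ε * x)) * Real.cos (ε * x)
        + k * sinTrunc ε x ^ (k - 1) * (-Real.sin (ε * x) * ε) := by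
  rw [deriv_sinTrunc_pow hε]
  have h1 := ((hasDerivAt_sinTrunc hε x).fun_pow (k - 1)).const_mul (k : ℝ)
  have h2 := ((hasDerivAt_id x).const_mul ε).cos
  have := (h1.mul h2).deriv
  refine Eq.trans this ?_
  simp

lemma abs_deriv_sinTrunc_pow_le {ε : ℝ} (hε : 0 < ε) (k : ℕ) (x : ℝ) :
    |deriv (fun x => sinTrunc ε x ^ k) x| ≤ (k ^ 2 + k : ℝ) * (1 + x ^ 2) ^ k := by
  rw [deriv_sinTrunc_pow hε, abs_mul, abs_mul, abs_pow, Nat.abs_cast]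
  have h1 : |sinTrunc ε x| ^ (k - 1) ≤ (1 + x ^ 2) ^ k :=
    (pow_le_pow_left₀ (abs_nonneg _) (abs_sinTrunc_le hε x) _).trans
      (abs_pow_le_one_add_sq_pow x (by omega))
  calc (k : ℝ) * |sinTrunc ε x| ^ (k - 1) * |Real.cos (ε * x)|
      ≤ (k ^ 2 + k) * (1 + x ^ 2) ^ k * 1 := by
        gcongr
        · nlinarith [sq_nonneg (k : ℝ)]
        · exact Real.abs_cos_le_one _
    _ = _ := mul_one _

lemma abs_deriv_deriv_sinTrunc_pow_le {ε : ℝ} (hε : 0 < ε) (hε1 : ε ≤ 1) (k : ℕ) (x : ℝ) :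
    |deriv (deriv (fun x => sinTrunc ε x ^ k)) x| ≤ (k ^ 2 + k : ℝ) * (1 + x ^ 2) ^ k := by
  rw [deriv_deriv_sinTrunc_pow hε]
  have h1 : ∀ i ≤ 2 * k, |sinTrunc ε x ^ i| ≤ (1 + x ^ 2) ^ k := fun i hi => by
    rw [abs_pow]
    exact (pow_le_pow_left₀ (abs_nonneg _) (abs_sinTrunc_le hε x) _).trans
      (abs_pow_le_one_add_sq_pow x hi)
  have hc := Real.abs_cos_le_one (ε * x)
  have hs := Real.abs_sin_le_one (ε * x)
  have hk : (((k - 1 : ℕ) : ℝ)) ≤ k := by exact_mod_cast Nat.sub_le k 1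
  refine (abs_add_le _ _).trans ?_
  rw [add_mul]
  refine add_le_add ?_ ?_
  · rw [abs_mul, abs_mul, abs_mul, abs_mul, Nat.abs_cast, Nat.abs_cast]
    calc (k : ℝ) * ((k - 1 : ℕ) * |sinTrunc ε x ^ (k - 1 - 1)| * |Real.cos (ε * x)|)
          * |Real.cos (ε * x)| ≤ k * (k * (1 + x ^ 2) ^ k * 1) * 1 := by
          gcongr
          exact h1 _ (by omega)
      _ = _ := by ring
  · rw [abs_mul, abs_mul, abs_mul, abs_neg, Nat.abs_cast, abs_of_pos hε]
    calc (k : ℝ) * |sinTrunc ε x ^ (k - 1)| * (|Real.sin (ε * x)| * ε)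
        ≤ k * (1 + x ^ 2) ^ k * (1 * 1) := by
          gcongr
          exact h1 _ (by omega)
      _ = _ := by ring

lemma tendsto_sinTrunc {ε : ℕ → ℝ} (hε : ∀ N, 0 < ε N) (hlim : Tendsto ε atTop (𝓝 0)) (x : ℝ) :
    Tendsto (fun N => sinTrunc (ε N) x) atTop (𝓝 x) := by
  -- `sin(εx)/ε` is the difference quotient at zero of `t ↦ sin(tx)`.
  have h : HasDerivAt (fun t => Real.sin (t * x)) x 0 := by
    simpa using ((hasDerivAt_id (0 : ℝ)).mul_const x).sin
  have h2 := h.tendsto_slope_zero_right.comp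
    (tendsto_nhdsWithin_iff.2 ⟨hlim, Eventually.of_forall fun N => hε N⟩)
  refine h2.congr fun N => ?_
  simp [sinTrunc, div_eq_inv_mul]

lemma IsPolynomialOperator.tendsto_generator_sinTrunc_pow (hpol : IsPolynomialOperator b σ ℓ)
    {ε : ℕ → ℝ} (hε : ∀ N, 0 < ε N) (hε1 : ∀ N, ε N ≤ 1) (hlim : Tendsto ε atTop (𝓝 0))
    (k : ℕ) (x : ℝ) :
    Tendsto (fun N => generator b σ ℓ (fun u => sinTrunc (ε N) u ^ k) x) atTop
      (𝓝 (generator b σ ℓ (fun u => u ^ k) x)) := by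
  have hs := fun x => tendsto_sinTrunc hε hlim x
  have hl : Tendsto (fun N => ε N * x) atTop (𝓝 0) := by simpa using hlim.mul_const x
  have hc : Tendsto (fun N => Real.cos (ε N * x)) atTop (𝓝 1) := by
    rw [← Real.cos_zero]; exact (Real.continuous_cos.tendsto 0).comp hl
  have hsin : Tendsto (fun N => -Real.sin (ε N * x) * ε N) atTop (𝓝 0) := by
    have := ((Real.continuous_sin.tendsto 0).comp hl).neg.mul hlim
    rw [mul_zero] at this
    exact this
  have hd : deriv (fun u : ℝ => u ^ k) = fun u : ℝ => (k : ℝ) * u ^ (k - 1) := by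
    ext; simp
  have hdd : deriv (fun u : ℝ => k * u ^ (k - 1)) x = k * ((k - 1 : ℕ) * x ^ (k - 1 - 1)) := by
    rw [deriv_const_mul_field]; simp
  have h1 : Tendsto (fun N => deriv (fun u => sinTrunc (ε N) u ^ k) x) atTop
      (𝓝 (deriv (fun u : ℝ => u ^ k) x)) := by
    simp_rw [fun N => deriv_sinTrunc_pow (hε N) k, hd]
    simpa using (((hs x).pow (k - 1)).const_mul (k : ℝ)).mul hc
  have h2 : Tendsto (fun N => deriv (deriv (fun u => sinTrunc (ε N) u ^ k)) x) atTop
      (𝓝 (deriv (deriv (fun u : ℝ => u ^ k)) x)) := by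
    simp_rw [fun N => deriv_deriv_sinTrunc_pow (hε N) k, hd, hdd]
    have a := (((((hs x).pow (k - 1 - 1)).const_mul ((k - 1 : ℕ) : ℝ)).mul hc).const_mul
      (k : ℝ)).mul hc
    have b := (((hs x).pow (k - 1)).const_mul (k : ℝ)).mul hsin
    simpa using a.add b
  have h3 : Tendsto (fun N => ∫ z, (sinTrunc (ε N) (x + z) ^ k - sinTrunc (ε N) x ^ k
      - deriv (fun u => sinTrunc (ε N) u ^ k) x * z) ∂(ℓ x)) atTop
      (𝓝 (∫ z, ((x + z) ^ k - x ^ k - deriv (fun u : ℝ => u ^ k) x * z) ∂(ℓ x))) := by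
    refine tendsto_integral_of_dominated_convergence
      (fun z => (k ^ 2 + k : ℝ) * (2 ^ k * (1 + x ^ 2) ^ k) * (z ^ 2 * (1 + z ^ 2) ^ k))
      (fun N => ?_) ((hpol.integrable_weight k x).const_mul _)
      (fun N => ae_of_all _ fun z => ?_) (ae_of_all _ fun z => ?_)
    · have := (contDiff_sinTrunc_pow (ε N) k).continuous
      exact Continuous.aestronglyMeasurable (((this.comp (continuous_const.add continuous_id)).sub
        continuous_const).sub (by fun_prop))
    · exact abs_increment_le (contDiff_sinTrunc_pow (ε N) k) (by positivity)
        (abs_deriv_deriv_sinTrunc_pow_le (hε N) (hε1 N) k) x z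
    · exact (((hs (x + z)).pow k).sub ((hs x).pow k)).sub (h1.mul_const z)
  exact ((h1.const_mul (b x)).add (h2.const_mul (1 / 2 * σ x ^ 2))).add h3

/-! ### Right-continuous processes -/

lemma measurable_comp_countable_time {Ω : Type*} {mΩ : MeasurableSpace Ω}
    {Y : ℝ≥0 → Ω → ℝ} (hm : ∀ t, Measurable (Y t)) (c : ℕ → ℝ≥0) {N : ℝ≥0 → ℕ}
    (hN : Measurable N) : Measurable (fun q : ℝ≥0 × Ω => Y (c (N q.1)) q.2) := by
  have h1 : Measurable (fun q : ℕ × Ω => Y (c q.1) q.2) :=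
    measurable_from_prod_countable_right fun k => hm (c k)
  exact h1.comp ((hN.comp measurable_fst).prodMk measurable_snd)

lemma measurable_uncurry_of_rightContinuous {Ω : Type*} {mΩ : MeasurableSpace Ω}
    {Y : ℝ≥0 → Ω → ℝ} (hm : ∀ t, Measurable (Y t))
    (hc : ∀ ω t, ContinuousWithinAt (fun u => Y u ω) (Set.Ici t) t) :
    Measurable (fun q : ℝ≥0 × Ω => Y q.1 q.2) := by
  -- The next point of the grid of mesh `1/(n+1)`. The added `1` in the numerator places it to the
  -- right of `u`, where right-continuity can be used.
  let d : ℕ → ℝ≥0 → ℝ≥0 := fun n u => (⌊((n : ℝ≥0) + 1) * u⌋₊ + 1) / ((n : ℝ≥0) + 1)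
  have hd1 : ∀ n u, u ≤ d n u := fun n u => by
    rw [le_div_iff₀ (by positivity), mul_comm]
    exact (Nat.lt_floor_add_one _).le
  have hd2 : ∀ n u, d n u ≤ u + 1 / ((n : ℝ≥0) + 1) := fun n u => by
    rw [div_le_iff₀ (by positivity), add_mul u, div_mul_cancel₀ _ (by positivity), mul_comm u]
    gcongr
    exact Nat.floor_le (by positivity)
  have hlim : ∀ u, Tendsto (fun n => d n u) atTop (𝓝 u) := fun u => by
    have : Tendsto (fun n : ℕ => u + 1 / ((n : ℝ≥0) + 1)) atTop (𝓝 (u + 0)) :=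
      tendsto_const_nhds.add tendsto_one_div_add_atTop_nhds_zero_nat
    rw [add_zero] at this
    exact tendsto_of_tendsto_of_tendsto_of_le_of_le tendsto_const_nhds this
      (fun n => hd1 n u) (fun n => hd2 n u)
  refine measurable_of_tendsto_metrizable (f := fun n (q : ℝ≥0 × Ω) => Y (d n q.1) q.2)
    (fun n => ?_) (tendsto_pi_nhds.2 fun q => ?_)
  · exact measurable_comp_countable_time hm (fun k : ℕ => ((k : ℝ≥0) + 1) / ((n : ℝ≥0) + 1))
      (N := fun u => ⌊((n : ℝ≥0) + 1) * u⌋₊) (Nat.measurable_floor.comp (measurable_id.const_mul _))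
  · exact (hc q.2 q.1).tendsto.comp
      (tendsto_nhdsWithin_iff.2 ⟨hlim q.1, Eventually.of_forall fun n => hd1 n q.1⟩)

/-- One-sided limits make `g` bounded near each point, and compactness of `[0, T]` reduces to
finitely many such neighbourhoods. -/
lemma exists_bound_of_cadlag {g : ℝ≥0 → ℝ} (hr : ∀ t, ContinuousWithinAt g (Set.Ici t) t)
    (hl : ∀ t, ∃ l : ℝ, Tendsto g (𝓝[<] t) (𝓝 l)) (T : ℝ≥0) :
    ∃ R, ∀ u ≤ T, |g u| ≤ R := by
  have key : ∃ R, ∀ u ∈ Set.Icc 0 T, |g u| ≤ R := by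
    refine isCompact_Icc.induction_on (p := fun s => ∃ R, ∀ u ∈ s, |g u| ≤ R) ⟨0, by simp⟩
      (fun s t hst ⟨R, hR⟩ => ⟨R, fun u hu => hR u (hst hu)⟩)
      (fun s t ⟨R, hR⟩ ⟨R', hR'⟩ => ⟨max R R', ?_⟩) fun t _ => ?_
    · rintro u (hu | hu)
      · exact (hR u hu).trans (le_max_left _ _)
      · exact (hR' u hu).trans (le_max_right _ _)
    · obtain ⟨l, hl⟩ := hl t
      have h1 : ∀ᶠ u in 𝓝[<] t, |g u| ≤ |l| + 1 :=
        (hl.abs.eventually_lt_const (lt_add_one |l|)).mono fun u hu => hu.le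
      have h2 : ∀ᶠ u in 𝓝[≥] t, |g u| ≤ |g t| + 1 :=
        ((hr t).tendsto.abs.eventually_lt_const (lt_add_one |g t|)).mono fun u hu => hu.le
      refine ⟨{u | |g u| ≤ |l| + 1 + (|g t| + 1)}, mem_nhdsWithin_of_mem_nhds ?_, _, fun u hu => hu⟩
      rw [← nhdsLT_sup_nhdsGE]
      have a1 := abs_nonneg l
      have a2 := abs_nonneg (g t)
      exact ⟨h1.mono fun u (hu : |g u| ≤ |l| + 1) => by linarith,
        h2.mono fun u (hu : |g u| ≤ |g t| + 1) => by linarith⟩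
  obtain ⟨R, hR⟩ := key
  exact ⟨R, fun u hu => hR u ⟨zero_le, hu⟩⟩

/-! ### Integral inequalities -/

/-- Grönwall's inequality in integral form. -/
lemma gronwall_integral {u : ℝ → ℝ} {T a C K : ℝ} (ha : 0 ≤ a) (hC : 0 ≤ C)
    (hu : IntervalIntegrable u volume 0 T) (hK : ∀ t ∈ Set.Icc 0 T, u t ≤ K)
    (h : ∀ t ∈ Set.Icc 0 T, u t ≤ a + C * ∫ s in (0 : ℝ)..t, u s) :
    ∀ t ∈ Set.Icc 0 T, u t ≤ a * Real.exp (C * t) := by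
  -- Iteration of the inequality starting from the bound `K`. The remainder tends to zero, and no
  -- continuity of `u` is needed.
  have key : ∀ n : ℕ, ∀ t ∈ Set.Icc 0 T,
      u t ≤ a * Real.exp (C * t) + K * ((C * t) ^ n / n.factorial) := by
    intro n
    induction n with
    | zero =>
      intro t ht
      have := hK t ht
      have : 0 ≤ a * Real.exp (C * t) := by positivity
      simp; linarith
    | succ n ih =>
      intro t ht
      have hut : IntervalIntegrable u volume 0 t := hu.mono_set (by
        rw [Set.uIcc_of_le ht.1, Set.uIcc_of_le (ht.1.trans ht.2)]
        exact Set.Icc_subset_Icc le_rfl ht.2)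
      have hd : ∀ s, HasDerivAt (fun s => a * Real.exp (C * s)
          + K * ((C * s) ^ (n + 1) / (n + 1).factorial))
          (C * (a * Real.exp (C * s) + K * ((C * s) ^ n / n.factorial))) s := by
        intro s
        have h1 : HasDerivAt (fun s => C * s) C s := by
          simpa using (hasDerivAt_id s).const_mul C
        have h2 := (h1.exp.const_mul a).add (((h1.pow (n + 1)).div_const
          ((n + 1).factorial : ℝ)).const_mul K)
        refine h2.congr_deriv ?_
        rw [Nat.factorial_succ]
        have := Nat.factorial_ne_zero n
        push_cast
        field_simp
      have hcont : Continuous fun s => a * Real.exp (C * s) + K * ((C * s) ^ n / n.factorial) := by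
        fun_prop
      have hint := intervalIntegral.integral_eq_sub_of_hasDerivAt (a := 0) (b := t)
        (fun s _ => hd s) ((continuous_const.mul hcont).intervalIntegrable _ _)
      rw [intervalIntegral.integral_const_mul] at hint
      calc u t ≤ a + C * ∫ s in (0 : ℝ)..t, u s := h t ht
        _ ≤ a + C * ∫ s in (0 : ℝ)..t, (a * Real.exp (C * s) + K * ((C * s) ^ n / n.factorial)) := by
          gcongr
          refine intervalIntegral.integral_mono_on ht.1 hut (hcont.intervalIntegrable _ _)
            fun s hs => ih s ⟨hs.1, hs.2.trans ht.2⟩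
        _ = _ := by
          rw [hint]; simp
  intro t ht
  have hlim : Tendsto (fun n : ℕ => a * Real.exp (C * t) + K * ((C * t) ^ n / n.factorial)) atTop
      (𝓝 (a * Real.exp (C * t) + K * 0)) :=
    ((FloorSemiring.tendsto_pow_div_factorial_atTop (C * t)).const_mul K).const_add _
  rw [mul_zero, add_zero] at hlim
  exact ge_of_tendsto' hlim fun n => key n t ht

lemma hasDerivAt_exp_smul_mulVec {k : ℕ} (G : Matrix (Fin k) (Fin k) ℝ) (v : Fin k → ℝ)
    (i : Fin k) (u : ℝ) :
    HasDerivAt (fun u : ℝ => (NormedSpace.exp (u • G) *ᵥ v) i)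
      ((G *ᵥ (NormedSpace.exp (u • G) *ᵥ v)) i) u := by
  let : NormedRing (Matrix (Fin k) (Fin k) ℝ) := Matrix.linftyOpNormedRing
  let : NormedAlgebra ℝ (Matrix (Fin k) (Fin k) ℝ) := Matrix.linftyOpNormedAlgebra
  have h := hasDerivAt_exp_smul_const' (𝕂 := ℝ) G u
  let φ : Matrix (Fin k) (Fin k) ℝ →ₗ[ℝ] ℝ :=
    { toFun := fun M => (M *ᵥ v) i
      map_add' := fun A B => by simp [Matrix.add_mulVec]
      map_smul' := fun c A => by simp [Matrix.smul_mulVec] }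
  have h2 := (LinearMap.toContinuousLinearMap φ).hasFDerivAt.comp_hasDerivAt u h
  rw [Matrix.mulVec_mulVec]
  exact h2

/-- Uniqueness for linear integral equations with constant coefficients. -/
lemma eq_exp_mulVec_of_integral_eq {k : ℕ} (G : Matrix (Fin k) (Fin k) ℝ) {m : ℝ → Fin k → ℝ}
    {T K : ℝ} (hT : 0 ≤ T) (hint : ∀ i, IntervalIntegrable (fun u => m u i) volume 0 T)
    (hK : ∀ i, ∀ t ∈ Set.Icc 0 T, |m t i| ≤ K)
    (h : ∀ i, ∀ t ∈ Set.Icc 0 T, m t i = m 0 i + ∫ u in (0 : ℝ)..t, (G *ᵥ m u) i) :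
    m T = NormedSpace.exp (T • G) *ᵥ m 0 := by
  let e : ℝ → Fin k → ℝ := fun u => NormedSpace.exp (u • G) *ᵥ m 0
  have hde : ∀ i u, HasDerivAt (fun u => e u i) ((G *ᵥ e u) i) u := fun i u =>
    hasDerivAt_exp_smul_mulVec G (m 0) i u
  have hce : ∀ i, Continuous fun u => e u i := fun i =>
    continuous_iff_continuousAt.2 fun u => (hde i u).continuousAt
  have hcGe : ∀ i, Continuous fun u => (G *ᵥ e u) i := fun i => by
    simp only [Matrix.mulVec, dotProduct]
    exact continuous_finsetSum _ fun j _ => continuous_const.mul (hce j)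
  have he0 : e 0 = m 0 := by simp [e]
  have hsub : ∀ t ∈ Set.Icc 0 T, Set.uIcc 0 t ⊆ Set.uIcc 0 T := fun t ht => by
    rw [Set.uIcc_of_le ht.1, Set.uIcc_of_le hT]
    exact Set.Icc_subset_Icc le_rfl ht.2
  have hie : ∀ i, ∀ t, e t i = m 0 i + ∫ u in (0 : ℝ)..t, (G *ᵥ e u) i := fun i t => by
    rw [intervalIntegral.integral_eq_sub_of_hasDerivAt (fun u _ => hde i u)
      ((hcGe i).intervalIntegrable _ _), he0]
    ring
  let d : ℝ → Fin k → ℝ := fun u => m u - e u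
  have hdint : ∀ i, ∀ t ∈ Set.Icc 0 T, IntervalIntegrable (fun u => d u i) volume 0 t :=
    fun i t ht => ((hint i).mono_set (hsub t ht)).sub ((hce i).intervalIntegrable _ _)
  have hGm : ∀ i, ∀ t ∈ Set.Icc 0 T, IntervalIntegrable (fun u => (G *ᵥ m u) i) volume 0 t := by
    intro i t ht
    simp only [Matrix.mulVec, dotProduct]
    have := IntervalIntegrable.sum (μ := volume) (a := 0) (b := t) Finset.univ
      (f := fun j u => G i j * m u j) fun j _ => ((hint j).mono_set (hsub t ht)).const_mul (G i j)
    simpa [Finset.sum_fn] using this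
  have hd : ∀ i, ∀ t ∈ Set.Icc 0 T, d t i = ∫ u in (0 : ℝ)..t, (G *ᵥ d u) i := by
    intro i t ht
    have : (fun u => (G *ᵥ d u) i) = fun u => (G *ᵥ m u) i - (G *ᵥ e u) i := by
      ext u; simp [d, Matrix.mulVec_sub]
    rw [this, intervalIntegral.integral_sub (hGm i t ht) ((hcGe i).intervalIntegrable _ _)]
    have h1 := h i t ht
    have h2 := hie i t
    simp only [d, Pi.sub_apply]
    linarith
  -- The `ℓ¹` distance between the two solutions satisfies Grönwall's hypothesis with initial
  -- constant zero.
  let D : ℝ → ℝ := fun u => ∑ i, |d u i|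
  have hDint : ∀ t ∈ Set.Icc 0 T, IntervalIntegrable D volume 0 t := fun t ht => by
    have := IntervalIntegrable.sum (μ := volume) (a := 0) (b := t) Finset.univ
      (f := fun j u => |d u j|) fun j _ => (hdint j t ht).abs
    simpa [Finset.sum_fn] using this
  obtain ⟨K', hK'⟩ : ∃ K', ∀ i, ∀ t ∈ Set.Icc 0 T, |e t i| ≤ K' := by
    have : ∀ i, ∃ K', ∀ t ∈ Set.Icc 0 T, ‖e t i‖ ≤ K' := fun i =>
      isCompact_Icc.exists_bound_of_continuousOn (hce i).continuousOn
    choose K' hK' using this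
    refine ⟨∑ i, |K' i|, fun i t ht => (hK' i t ht).trans ((le_abs_self _).trans ?_)⟩
    exact Finset.single_le_sum (f := fun i => |K' i|) (fun _ _ => abs_nonneg _) (Finset.mem_univ i)
  have hDK : ∀ t ∈ Set.Icc 0 T, D t ≤ ∑ _i : Fin k, (K + K') := fun t ht =>
    Finset.sum_le_sum fun i _ => (abs_sub _ _).trans (add_le_add (hK i t ht) (hK' i t ht))
  have hDle : ∀ t ∈ Set.Icc 0 T, D t ≤ 0 + (∑ i, ∑ j, |G i j|) * ∫ s in (0 : ℝ)..t, D s := by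
    intro t ht
    rw [zero_add, Finset.sum_mul]
    refine Finset.sum_le_sum fun i _ => ?_
    rw [hd i t ht, ← intervalIntegral.integral_const_mul]
    refine (intervalIntegral.abs_integral_le_integral_abs ht.1).trans ?_
    refine intervalIntegral.integral_mono_on_of_le_Ioo ht.1 ?_ ((hDint t ht).const_mul _) ?_
    · have : (fun u => (G *ᵥ d u) i) = fun u => (G *ᵥ m u) i - (G *ᵥ e u) i := by
        ext u; simp [d, Matrix.mulVec_sub]
      have h' := (hGm i t ht).sub ((hcGe i).intervalIntegrable 0 t)
      rw [← this] at h'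
      exact h'.abs
    · intro u _
      simp only [Matrix.mulVec, dotProduct]
      refine (Finset.abs_sum_le_sum_abs _ _).trans ?_
      rw [Finset.sum_mul]
      refine Finset.sum_le_sum fun j _ => ?_
      rw [abs_mul]
      gcongr
      exact Finset.single_le_sum (f := fun i => |d u i|) (fun _ _ => abs_nonneg _)
        (Finset.mem_univ j)
  have hfin := gronwall_integral le_rfl (by positivity) (hDint T ⟨hT, le_rfl⟩) hDK hDle T
    ⟨hT, le_rfl⟩
  rw [zero_mul] at hfin
  ext i
  have h0 : |d T i| ≤ 0 := (Finset.single_le_sum (f := fun i => |d T i|)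
    (fun _ _ => abs_nonneg _) (Finset.mem_univ i)).trans hfin
  have h1 := abs_nonpos_iff.1 h0
  simp only [d, Pi.sub_apply] at h1
  exact sub_eq_zero.1 h1

/-! ### Local martingales -/

variable {Ω : Type*} {mΩ : MeasurableSpace Ω} {P : Measure Ω} {𝓕 : Filtration ℝ≥0 mΩ}

/-- A stopped path only shows values of the original path up to time `t`, or zero; pathwise bounds
on `[0, t]` that allow the value zero therefore survive localization. -/
lemma exists_stopped_eq (M : ℝ≥0 → Ω → ℝ) (τ : Ω → WithTop ℝ≥0) (t : ℝ≥0) (ω : Ω) :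
    ∃ u ≤ t, stoppedProcess (fun i => {ω | ⊥ < τ ω}.indicator (M i)) τ t ω
      = {ω | ⊥ < τ ω}.indicator (M u) ω := by
  refine ⟨(min (t : WithTop ℝ≥0) (τ ω)).untopA, ?_, rfl⟩
  cases h : τ ω with
  | top => rw [min_eq_left le_top]; exact le_rfl
  | coe a => rw [← WithTop.coe_min]; exact min_le_left t a

lemma stopped_eq_of_lt (M : ℝ≥0 → Ω → ℝ) (τ : Ω → WithTop ℝ≥0) {t : ℝ≥0} {ω : Ω}
    (h : (t : WithTop ℝ≥0) < τ ω) :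
    stoppedProcess (fun i => {ω | ⊥ < τ ω}.indicator (M i)) τ t ω = M t ω := by
  have h0 : ω ∈ {ω | ⊥ < τ ω} := lt_of_le_of_lt bot_le h
  simp only [stoppedProcess, min_eq_left h.le]
  exact Set.indicator_of_mem h0 _

lemma tendsto_stopped (M : ℝ≥0 → Ω → ℝ) {τ : ℕ → Ω → WithTop ℝ≥0} (t : ℝ≥0) {ω : Ω}
    (h : Tendsto (τ · ω) atTop (𝓝 ⊤)) :
    Tendsto (fun n => stoppedProcess (fun i => {ω | ⊥ < τ n ω}.indicator (M i)) (τ n) t ω) atTop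
      (𝓝 (M t ω)) := by
  have : ∀ᶠ n in atTop, (t : WithTop ℝ≥0) < τ n ω :=
    h.eventually (lt_mem_nhds (WithTop.coe_lt_top t))
  exact tendsto_const_nhds.congr' (this.mono fun n hn => (stopped_eq_of_lt M (τ n) hn).symm)

/-- A local martingale dominated on `[0, t]` by an integrable random variable has the martingale
property on `[0, t]`. -/
lemma IsLocalMartingale.setIntegral_eq [IsFiniteMeasure P] {M : ℝ≥0 → Ω → ℝ}
    (hM : IsLocalMartingale M 𝓕 P) {s t : ℝ≥0} (hst : s ≤ t) {g : Ω → ℝ} (hg : Integrable g P)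
    (hMg : ∀ᵐ ω ∂P, ∀ u ≤ t, |M u ω| ≤ g ω) {A : Set Ω} (hA : MeasurableSet[𝓕 s] A) :
    ∫ ω in A, M t ω ∂P = ∫ ω in A, M s ω ∂P := by
  obtain ⟨τ, hτ, hN⟩ := hM
  have key : ∀ v ≤ t, Tendsto (fun n => ∫ ω in A,
      stoppedProcess (fun i => {ω | ⊥ < τ n ω}.indicator (M i)) (τ n) v ω ∂P) atTop
      (𝓝 (∫ ω in A, M v ω ∂P)) := by
    intro v hv
    refine tendsto_integral_of_dominated_convergence g
      (fun n => ((hN n).integrable v).aestronglyMeasurable.restrict) hg.restrict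
      (fun n => ae_restrict_of_ae ?_) (ae_restrict_of_ae ?_)
    · filter_upwards [hMg] with ω hω
      obtain ⟨u, hu, h⟩ := exists_stopped_eq M (τ n) v ω
      rw [h]
      refine (norm_indicator_le_norm_self _ _).trans (hω u (hu.trans hv))
    · filter_upwards [hτ.tendsto_top] with ω hω
      exact tendsto_stopped M v hω
  refine tendsto_nhds_unique (key t le_rfl) ((key s hst).congr fun n => ?_)
  exact (hN n).setIntegral_eq hst hA

/-- A random variable dominated by a local martingale that starts at zero and is bounded below has
nonpositive expectation. -/
lemma IsLocalMartingale.integral_nonpos [IsProbabilityMeasure P] {M : ℝ≥0 → Ω → ℝ}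
    (hM : IsLocalMartingale M 𝓕 P) (hM0 : ∀ᵐ ω ∂P, M 0 ω = 0) {t : ℝ≥0} {c : ℝ} (hc : 0 ≤ c)
    (hMc : ∀ ω, ∀ u ≤ t, -c ≤ M u ω) {L : Ω → ℝ} (hL : Integrable L P)
    (hLc : ∀ ω, -c ≤ L ω) (hLM : ∀ ω, L ω ≤ M t ω) : ∫ ω, L ω ∂P ≤ 0 := by
  obtain ⟨τ, hτ, hN⟩ := hM
  set N := fun n => stoppedProcess (fun i => {ω | ⊥ < τ n ω}.indicator (M i)) (τ n) with hNdef
  -- Adding `c` makes the stopped processes nonnegative, so Fatou's lemma applies along the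
  -- localizing sequence; each shifted process has expectation `c`.
  have hNc : ∀ n ω, 0 ≤ N n t ω + c := fun n ω => by
    obtain ⟨u, hu, h⟩ := exists_stopped_eq M (τ n) t ω
    simp only [hNdef, h]
    by_cases hω : ω ∈ {ω | ⊥ < τ n ω}
    · rw [Set.indicator_of_mem hω]; linarith [hMc ω u hu]
    · rw [Set.indicator_of_notMem hω]; linarith
  have hNint : ∀ n, Integrable (fun ω => N n t ω + c) P := fun n =>
    ((hN n).integrable t).add (integrable_const c)
  have hNE : ∀ n, ∫ ω, (N n t ω + c) ∂P = c := fun n => by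
    rw [integral_add ((hN n).integrable t) (integrable_const c), integral_const]
    have h1 := (hN n).setIntegral_eq (zero_le : 0 ≤ t) MeasurableSet.univ
    simp only [setIntegral_univ] at h1
    have h2 : ∫ ω, N n 0 ω ∂P = 0 := by
      refine integral_eq_zero_of_ae ?_
      filter_upwards [hM0] with ω hω
      obtain ⟨u, hu, h⟩ := exists_stopped_eq M (τ n) 0 ω
      rw [nonpos_iff_eq_zero.1 hu] at h
      simp only [hNdef, h, Set.indicator_apply, hω]
      simp
    rw [← h1, h2]; simp
  have hle : ENNReal.ofReal (∫ ω, (L ω + c) ∂P) ≤ ENNReal.ofReal c := by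
    calc ENNReal.ofReal (∫ ω, (L ω + c) ∂P) = ∫⁻ ω, ENNReal.ofReal (L ω + c) ∂P :=
          ofReal_integral_eq_lintegral_ofReal (hL.add (integrable_const c))
            (ae_of_all _ fun ω => by have := hLc ω; simp only [Pi.zero_apply]; linarith)
      _ ≤ ∫⁻ ω, liminf (fun n => ENNReal.ofReal (N n t ω + c)) atTop ∂P := by
          refine lintegral_mono_ae ?_
          filter_upwards [hτ.tendsto_top] with ω hω
          have := (ENNReal.tendsto_ofReal ((tendsto_stopped M t hω).add_const c)).liminf_eq
          rw [this]
          exact ENNReal.ofReal_le_ofReal (by linarith [hLM ω])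
      _ ≤ liminf (fun n => ∫⁻ ω, ENNReal.ofReal (N n t ω + c) ∂P) atTop :=
          lintegral_liminf_le' fun n => (hNint n).aestronglyMeasurable.aemeasurable.ennreal_ofReal
      _ = ENNReal.ofReal c := by
          simp_rw [← fun n => ofReal_integral_eq_lintegral_ofReal (hNint n)
            (ae_of_all _ (hNc n)), hNE]
          simp
  rw [ENNReal.ofReal_le_ofReal_iff hc, integral_add hL (integrable_const c), integral_const] at hle
  simpa using hle

variable {y : ℝ} {Y : ℝ≥0 → Ω → ℝ}

/-! ### Moments of polynomial jump-diffusions -/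

lemma IsJumpDiffusion.measurable (hY : IsJumpDiffusion b σ ℓ 𝓕 P y Y) (t : ℝ≥0) :
    Measurable (Y t) :=
  ((hY.adapted t).mono (𝓕.le t)).measurable

lemma IsJumpDiffusion.measurable_uncurry (hY : IsJumpDiffusion b σ ℓ 𝓕 P y Y) :
    Measurable (fun q : ℝ × Ω => Y q.1.toNNReal q.2) :=
  (measurable_uncurry_of_rightContinuous hY.measurable hY.right_continuous).comp
    ((measurable_real_toNNReal.comp measurable_fst).prodMk measurable_snd)

lemma IsJumpDiffusion.intervalIntegrable (hY : IsJumpDiffusion b σ ℓ 𝓕 P y Y) {g : ℝ → ℝ}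
    (hg : Measurable g) (hb : ∀ R, ∃ C, ∀ x, |x| ≤ R → |g x| ≤ C) (ω : Ω) (s t : ℝ) :
    IntervalIntegrable (fun u : ℝ => g (Y u.toNNReal ω)) volume s t := by
  obtain ⟨R, hR⟩ := exists_bound_of_cadlag (hY.right_continuous ω) (hY.left_limits ω)
    (max s t).toNNReal
  obtain ⟨C, hC⟩ := hb R
  have hm : Measurable (fun u : ℝ => g (Y u.toNNReal ω)) :=
    hg.comp (hY.measurable_uncurry.comp measurable_prodMk_right)
  rw [intervalIntegrable_iff]
  refine Measure.integrableOn_of_bounded (M := C) (by simp) hm.aestronglyMeasurable ?_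
  rw [ae_restrict_iff' measurableSet_uIoc]
  refine ae_of_all _ fun u hu => hC _ (hR _ (Real.toNNReal_le_toNNReal ?_))
  exact (Set.mem_Ioc.1 hu).2

lemma IsJumpDiffusion.intervalIntegrable_generator (hop : IsJumpDiffusionOperator b σ ℓ)
    (hpol : IsPolynomialOperator b σ ℓ) (hY : IsJumpDiffusion b σ ℓ 𝓕 P y Y) {f : ℝ → ℝ}
    (hf : ContDiff ℝ 2 f) {B : ℝ} (hB : ∀ x, |f x| ≤ B) (ω : Ω) (s t : ℝ) :
    IntervalIntegrable (fun u : ℝ => generator b σ ℓ f (Y u.toNNReal ω)) volume s t :=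
  hY.intervalIntegrable (hpol.measurable_generator hop hf.continuous)
    (hpol.exists_generator_le_of_bounded hf hB) ω s t

lemma IsJumpDiffusion.integrable_of_bounded [IsFiniteMeasure P]
    (hY : IsJumpDiffusion b σ ℓ 𝓕 P y Y) {g : ℝ → ℝ} (hg : Measurable g) {B : ℝ}
    (hB : ∀ x, |g x| ≤ B) (t : ℝ≥0) : Integrable (fun ω => g (Y t ω)) P :=
  Integrable.of_bound (hg.comp (hY.measurable t)).aestronglyMeasurable B
    (ae_of_all _ fun _ => hB _)

/-- Since `𝒢f ≤ Cf`, the local martingale of `f` dominates `f(Y_T) - f(y) - C ∫ f(Y)`, which is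
bounded. Only this one-sided control is available, so `IsLocalMartingale.integral_nonpos` replaces
the martingale property. It yields an integral inequality for the expectation, to which Grönwall
applies; the final bound does not depend on `ε`. -/
lemma IsJumpDiffusion.integral_truncPoly_le [IsProbabilityMeasure P]
    (hop : IsJumpDiffusionOperator b σ ℓ) (hpol : IsPolynomialOperator b σ ℓ)
    (hY : IsJumpDiffusion b σ ℓ 𝓕 P y Y) {V : ℝ[X]}
    (hV : ∀ x, 0 ≤ V.eval x) {C : ℝ} (hC : 0 ≤ C)
    (hVC : ∀ x, generator b σ ℓ (fun u => V.eval u) x ≤ C * V.eval x) {ε : ℝ} (hε : 0 < ε)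
    (t : ℝ≥0) : ∫ ω, truncPoly V ε (Y t ω) ∂P ≤ V.eval y * Real.exp (C * t) := by
  set f := truncPoly V ε with hf
  have hfC := contDiff_truncPoly hV hε
  have hfm : Measurable f := hfC.continuous.measurable
  have hf0 : ∀ x, 0 ≤ f x := truncPoly_nonneg hV hε
  have hfB : ∀ x, |f x| ≤ 1 / ε := abs_truncPoly_le hV hε
  have hfB' : ∀ x, f x ≤ 1 / ε := fun x => (le_abs_self _).trans (hfB x)
  have hii : ∀ ω s t, IntervalIntegrable (fun u : ℝ => f (Y u.toNNReal ω)) volume s t :=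
    hY.intervalIntegrable hfm fun R => ⟨1 / ε, fun x _ => hfB x⟩
  have hprod : ∀ T : ℝ, Integrable (fun q : ℝ × Ω => f (Y q.1.toNNReal q.2))
      ((volume.restrict (Set.Ioc 0 T)).prod P) := fun T =>
    Integrable.of_bound (hfm.comp hY.measurable_uncurry).aestronglyMeasurable (1 / ε)
      (ae_of_all _ fun q => hfB _)
  have hGf := hpol.generator_truncPoly_le hV hC hVC hε
  let w : ℝ → ℝ := fun u => ∫ ω, f (Y u.toNNReal ω) ∂P
  have hwint : ∀ T : ℝ, 0 ≤ T → IntervalIntegrable w volume 0 T := fun T hT => by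
    rw [intervalIntegrable_iff, Set.uIoc_of_le hT]
    exact (hprod T).integral_prod_left
  have hw : ∀ T : ℝ, 0 ≤ T → w T ≤ f y + C * ∫ s in (0 : ℝ)..T, w s := by
    intro T hT
    have hswap : ∫ ω, (∫ u in (0 : ℝ)..T, f (Y u.toNNReal ω)) ∂P = ∫ s in (0 : ℝ)..T, w s := by
      simp only [intervalIntegral.integral_of_le hT, w]
      exact (integral_integral_swap (f := fun (u : ℝ) ω => f (Y u.toNNReal ω)) (hprod T)).symm
    have hJint : Integrable (fun ω => ∫ u in (0 : ℝ)..T, f (Y u.toNNReal ω)) P := by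
      simp only [intervalIntegral.integral_of_le hT]
      exact (hprod T).integral_prod_right
    have hJle : ∀ ω, ∀ u : ℝ, 0 ≤ u → u ≤ T →
        ∫ v in (0 : ℝ)..u, f (Y v.toNNReal ω) ≤ T * (1 / ε) := fun ω u hu huT => by
      calc ∫ v in (0 : ℝ)..u, f (Y v.toNNReal ω) ≤ ∫ v in (0 : ℝ)..u, (1 / ε) :=
            intervalIntegral.integral_mono_on hu (hii ω _ _) (by simp) fun v _ => hfB' _
        _ = u * (1 / ε) := by simp
        _ ≤ _ := by gcongr
    have hgle : ∀ ω, ∀ u : ℝ, 0 ≤ u →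
        ∫ v in (0 : ℝ)..u, generator b σ ℓ f (Y v.toNNReal ω)
          ≤ C * ∫ v in (0 : ℝ)..u, f (Y v.toNNReal ω) := fun ω u hu => by
      rw [← intervalIntegral.integral_const_mul]
      exact intervalIntegral.integral_mono_on hu
        (hY.intervalIntegrable_generator hop hpol hfC hfB ω _ _) ((hii ω _ _).const_mul C)
        fun v _ => hGf _
    have hfint : Integrable (fun ω => f (Y T.toNNReal ω)) P := hY.integrable_of_bounded hfm hfB _
    have hfyint : Integrable (fun ω => f (Y T.toNNReal ω) - f y) P :=
      hfint.sub (integrable_const (f y))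
    have hLint := hfyint.sub (hJint.const_mul C)
    have hlow : ∀ ω, ∀ u : ℝ, 0 ≤ u → u ≤ T → -(1 / ε + C * (T * (1 / ε))) ≤
        f (Y u.toNNReal ω) - f y - C * ∫ v in (0 : ℝ)..u, f (Y v.toNNReal ω) := fun ω u hu huT => by
      have h1 := hf0 (Y u.toNNReal ω)
      have h2 := hfB' y
      have h3 := mul_le_mul_of_nonneg_left (hJle ω u hu huT) hC
      linarith
    -- The lower bound `c` combines `f(y) ≤ 1/ε` with `C ∫ f(Y) ≤ C T/ε`.
    have key := (hY.martingale_problem f hfC ⟨_, hfB⟩).integral_nonpos (t := T.toNNReal)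
      (c := 1 / ε + C * (T * (1 / ε))) (by
        filter_upwards [hY.initial] with ω hω
        simp [hω]) (by positivity) (fun ω u hu => ?_) hLint (fun ω => ?_) (fun ω => ?_)
    · have e : ∫ ω, (f (Y T.toNNReal ω) - f y - C * ∫ u in (0 : ℝ)..T, f (Y u.toNNReal ω)) ∂P
          = w T - f y - C * ∫ s in (0 : ℝ)..T, w s := by
        rw [integral_sub hfyint (hJint.const_mul C),
          integral_sub hfint (integrable_const _), integral_const_mul, hswap]
        simp [w]
      have key' : ∫ ω, (f (Y T.toNNReal ω) - f y - C * ∫ u in (0 : ℝ)..T, f (Y u.toNNReal ω)) ∂P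
          ≤ 0 := key
      rw [e] at key'
      linarith
    · have h1 := hgle ω u u.2
      have h2 := hlow ω u u.2 (by
        have := NNReal.coe_le_coe.2 hu
        rwa [Real.coe_toNNReal T hT] at this)
      rw [Real.toNNReal_coe] at h2
      linarith
    · exact hlow ω T hT le_rfl
    · have h1 := hgle ω T hT
      simp only [Pi.sub_apply, Real.coe_toNNReal T hT]
      linarith
  have hwK : ∀ u, w u ≤ 1 / ε := fun u => by
    calc w u ≤ ∫ _, 1 / ε ∂P := integral_mono (hY.integrable_of_bounded hfm hfB _)
          (integrable_const _) fun ω => hfB' _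
      _ = _ := by simp
  have := gronwall_integral (hf0 y) hC (hwint t t.2) (fun u _ => hwK u) (fun u hu => hw u hu.1)
    t ⟨t.2, le_rfl⟩
  simp only [w, Real.toNNReal_coe] at this
  refine this.trans ?_
  gcongr
  exact truncPoly_le hV hε y

/-- All moments of a polynomial jump-diffusion are finite, locally uniformly in time. -/
lemma IsJumpDiffusion.exists_moment_le [IsProbabilityMeasure P]
    (hop : IsJumpDiffusionOperator b σ ℓ) (hpol : IsPolynomialOperator b σ ℓ)
    (hY : IsJumpDiffusion b σ ℓ 𝓕 P y Y) (k : ℕ) :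
    ∃ C, 0 ≤ C ∧ ∀ t : ℝ≥0, Integrable (fun ω => (1 + Y t ω ^ 2) ^ k) P ∧
      ∫ ω, (1 + Y t ω ^ 2) ^ k ∂P ≤ (1 + y ^ 2) ^ k * Real.exp (C * t) := by
  let V : ℝ[X] := (1 + Polynomial.X ^ 2) ^ k
  have hVe : ∀ x, V.eval x = (1 + x ^ 2) ^ k := fun x => by simp [V]
  have hV : ∀ x, 0 ≤ V.eval x := fun x => by rw [hVe]; positivity
  have hdeg : V.natDegree ≤ 2 * k := by
    refine Polynomial.natDegree_pow_le.trans ?_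
    rw [mul_comm]
    gcongr
    compute_degree
  -- The generator does not raise the degree `2k` of `V`, so its image is bounded by a multiple of
  -- `(1 + x²)^k = V`.
  obtain ⟨q, hq, hVq⟩ := hpol.map_degree_le _ V hdeg
  obtain ⟨C, hC, hqC⟩ := exists_abs_eval_le q hq
  have hVC : ∀ x, generator b σ ℓ (fun u => V.eval u) x ≤ C * V.eval x := fun x => by
    rw [hVq, hVe]; exact (le_abs_self _).trans (hqC x)
  refine ⟨C, hC, fun t => ?_⟩
  have hlim : Tendsto (fun N : ℕ => 1 / ((N : ℝ) + 1)) atTop (𝓝 0) :=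
    tendsto_one_div_add_atTop_nhds_zero_nat
  have hm : Measurable fun ω => (1 + Y t ω ^ 2) ^ k := by
    have := hY.measurable t
    fun_prop
  have hle : ∫⁻ ω, ENNReal.ofReal ((1 + Y t ω ^ 2) ^ k) ∂P
      ≤ ENNReal.ofReal ((1 + y ^ 2) ^ k * Real.exp (C * t)) := by
    calc ∫⁻ ω, ENNReal.ofReal ((1 + Y t ω ^ 2) ^ k) ∂P
        = ∫⁻ ω, liminf (fun N : ℕ => ENNReal.ofReal (truncPoly V (1 / ((N : ℝ) + 1)) (Y t ω)))
            atTop ∂P := by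
          refine lintegral_congr fun ω => Eq.symm (Tendsto.liminf_eq ?_)
          refine ENNReal.tendsto_ofReal ?_
          have h1 : Tendsto (fun N : ℕ => 1 + 1 / ((N : ℝ) + 1) * V.eval (Y t ω)) atTop (𝓝 1) := by
            simpa using (hlim.mul_const (V.eval (Y t ω))).const_add 1
          have h2 := (tendsto_const_nhds (x := V.eval (Y t ω))).div h1 one_ne_zero
          simp only [div_one, hVe] at h2
          simp only [truncPoly, hVe]
          exact h2
      _ ≤ liminf (fun N : ℕ => ∫⁻ ω, ENNReal.ofReal (truncPoly V (1 / ((N : ℝ) + 1)) (Y t ω)) ∂P)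
            atTop := by
          refine lintegral_liminf_le fun N => ?_
          exact ((contDiff_truncPoly hV (by positivity)).continuous.measurable.comp
            (hY.measurable t)).ennreal_ofReal
      _ ≤ liminf (fun _ : ℕ => ENNReal.ofReal ((1 + y ^ 2) ^ k * Real.exp (C * t))) atTop := by
          refine liminf_le_liminf (Eventually.of_forall fun N => ?_)
          have hN : (0 : ℝ) < 1 / ((N : ℝ) + 1) := by positivity
          rw [← ofReal_integral_eq_lintegral_ofReal (hY.integrable_of_bounded
            (contDiff_truncPoly hV hN).continuous.measurable (abs_truncPoly_le hV hN) t)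
            (ae_of_all _ fun ω => truncPoly_nonneg hV hN _), ← hVe]
          exact ENNReal.ofReal_le_ofReal (hY.integral_truncPoly_le hop hpol hV hC hVC hN t)
      _ = _ := by simp
  have hpos : ∀ ω, 0 ≤ (1 + Y t ω ^ 2) ^ k := fun ω => by positivity
  have hint : Integrable (fun ω => (1 + Y t ω ^ 2) ^ k) P := by
    refine ⟨hm.aestronglyMeasurable, ?_⟩
    rw [hasFiniteIntegral_iff_ofReal (ae_of_all _ hpos)]
    exact hle.trans_lt ENNReal.ofReal_lt_top
  refine ⟨hint, ?_⟩
  rw [← ofReal_integral_eq_lintegral_ofReal hint (ae_of_all _ hpos),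
    ENNReal.ofReal_le_ofReal_iff (by positivity)] at hle
  exact hle

/-! ### The moment formula -/

lemma IsJumpDiffusion.integrable_prod_weight [IsProbabilityMeasure P]
    (hop : IsJumpDiffusionOperator b σ ℓ) (hpol : IsPolynomialOperator b σ ℓ)
    (hY : IsJumpDiffusion b σ ℓ 𝓕 P y Y) (k : ℕ) (s t : ℝ) :
    Integrable (fun q : ℝ × Ω => (1 + Y q.1.toNNReal q.2 ^ 2) ^ k)
      ((volume.restrict (Set.Ioc s t)).prod P) := by
  obtain ⟨C, hC, h⟩ := hY.exists_moment_le hop hpol k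
  have hm : Measurable (fun q : ℝ × Ω => (1 + Y q.1.toNNReal q.2 ^ 2) ^ k) :=
    ((hY.measurable_uncurry.pow_const 2).const_add 1).pow_const k
  rw [integrable_prod_iff hm.aestronglyMeasurable]
  refine ⟨ae_of_all _ fun u => (h u.toNNReal).1, ?_⟩
  refine Integrable.of_bound (hm.aestronglyMeasurable.norm.integral_prod_right')
    ((1 + y ^ 2) ^ k * Real.exp (C * t.toNNReal)) ?_
  rw [ae_restrict_iff' measurableSet_Ioc]
  refine ae_of_all _ fun u hu => ?_
  have hn : ∀ ω, ‖(1 + Y u.toNNReal ω ^ 2) ^ k‖ = (1 + Y u.toNNReal ω ^ 2) ^ k := fun ω =>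
    Real.norm_of_nonneg (by positivity)
  simp_rw [hn]
  rw [Real.norm_of_nonneg (integral_nonneg fun ω => by positivity)]
  refine (h u.toNNReal).2.trans ?_
  gcongr
  exact hu.2

lemma prod_restrict_right (μ : Measure ℝ) [SFinite μ] [SFinite P] (A : Set Ω) :
    μ.prod (P.restrict A) = (μ.prod P).restrict (Set.univ ×ˢ A) := by
  rw [← Measure.prod_restrict, Measure.restrict_univ]

lemma IsJumpDiffusion.integrable_prod_of_growth [IsProbabilityMeasure P]
    (hop : IsJumpDiffusionOperator b σ ℓ) (hpol : IsPolynomialOperator b σ ℓ)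
    (hY : IsJumpDiffusion b σ ℓ 𝓕 P y Y) {g : ℝ → ℝ} (hg : Measurable g) {K : ℝ} {k : ℕ}
    (hK : ∀ x, |g x| ≤ K * (1 + x ^ 2) ^ k) (s t : ℝ) :
    Integrable (fun q : ℝ × Ω => g (Y q.1.toNNReal q.2))
      ((volume.restrict (Set.Ioc s t)).prod P) :=
  ((hY.integrable_prod_weight hop hpol k s t).const_mul K).mono'
    (hg.comp hY.measurable_uncurry).aestronglyMeasurable (ae_of_all _ fun _ => hK _)

lemma IsJumpDiffusion.integrable_of_growth [IsProbabilityMeasure P]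
    (hop : IsJumpDiffusionOperator b σ ℓ) (hpol : IsPolynomialOperator b σ ℓ)
    (hY : IsJumpDiffusion b σ ℓ 𝓕 P y Y) {g : ℝ → ℝ} (hg : Measurable g) {K : ℝ} {k : ℕ}
    (hK : ∀ x, |g x| ≤ K * (1 + x ^ 2) ^ k) (t : ℝ≥0) :
    Integrable (fun ω => g (Y t ω)) P := by
  obtain ⟨C, -, h⟩ := hY.exists_moment_le hop hpol k
  exact ((h t).1.const_mul K).mono' (hg.comp (hY.measurable t)).aestronglyMeasurable
    (ae_of_all _ fun _ => hK _)

/-- Dynkin's formula for bounded functions whose generator has polynomial growth. -/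
lemma IsJumpDiffusion.setIntegral_eq_of_bounded [IsProbabilityMeasure P]
    (hop : IsJumpDiffusionOperator b σ ℓ) (hpol : IsPolynomialOperator b σ ℓ)
    (hY : IsJumpDiffusion b σ ℓ 𝓕 P y Y) {f : ℝ → ℝ} (hf : ContDiff ℝ 2 f) {B : ℝ}
    (hB : ∀ x, |f x| ≤ B) {K : ℝ} {k : ℕ}
    (hK : ∀ x, |generator b σ ℓ f x| ≤ K * (1 + x ^ 2) ^ k) {s t : ℝ≥0} (hst : s ≤ t)
    {A : Set Ω} (hA : MeasurableSet[𝓕 s] A) :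
    ∫ ω in A, f (Y t ω) ∂P = ∫ ω in A, f (Y s ω) ∂P
      + ∫ q : ℝ × Ω, generator b σ ℓ f (Y q.1.toNNReal q.2)
        ∂((volume.restrict (Set.Ioc (s : ℝ) t)).prod (P.restrict A)) := by
  have hGm := hpol.measurable_generator hop hf.continuous
  have hint := fun s t => hY.integrable_prod_of_growth hop hpol hGm hK s t
  have hK0 : 0 ≤ K := by
    have := (abs_nonneg _).trans (hK 0)
    simpa using this
  let I : ℝ≥0 → Ω → ℝ := fun v ω => ∫ u in (0 : ℝ)..v, generator b σ ℓ f (Y u.toNNReal ω)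
  have hii := fun ω => hY.intervalIntegrable_generator hop hpol hf hB ω
  have hIint : ∀ v, Integrable (I v) P := fun v => by
    simp only [I, intervalIntegral.integral_of_le v.coe_nonneg]
    exact (hint 0 v).integral_prod_right
  have hfint : ∀ v, Integrable (fun ω => f (Y v ω)) P := fun v =>
    hY.integrable_of_bounded hf.continuous.measurable hB v
  have hWint : Integrable (fun ω => ∫ u in (0 : ℝ)..t, K * (1 + Y u.toNNReal ω ^ 2) ^ k) P := by
    simp only [intervalIntegral.integral_of_le t.coe_nonneg]
    exact ((hY.integrable_prod_weight hop hpol k 0 t).const_mul K).integral_prod_right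
  have hWii : ∀ ω u v,
      IntervalIntegrable (fun u : ℝ => K * (1 + Y u.toNNReal ω ^ 2) ^ k) volume u v := fun ω u v =>
    hY.intervalIntegrable (g := fun x => K * (1 + x ^ 2) ^ k) (by fun_prop)
      (fun R => ⟨K * (1 + R ^ 2) ^ k, fun x hx => by
        have hR : x ^ 2 ≤ R ^ 2 := sq_le_sq.2 (hx.trans (le_abs_self R))
        rw [abs_of_nonneg (by positivity)]
        gcongr⟩) ω u v
  -- On `[0, t]` the local martingale is dominated by `2B` plus the time integral of the growth
  -- bound, which is integrable by the moment estimates.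
  have hmart := (hY.martingale_problem f hf ⟨B, hB⟩).setIntegral_eq hst
    (g := fun ω => B + B + ∫ u in (0 : ℝ)..t, K * (1 + Y u.toNNReal ω ^ 2) ^ k)
    ((integrable_const _).add hWint) (ae_of_all _ fun ω u hu => by
      have hut : (u : ℝ) ≤ t := hu
      refine (abs_sub _ _).trans (add_le_add ((abs_sub _ _).trans (add_le_add (hB _) (hB _))) ?_)
      calc |∫ v in (0 : ℝ)..u, generator b σ ℓ f (Y v.toNNReal ω)|
          ≤ ∫ v in (0 : ℝ)..u, |generator b σ ℓ f (Y v.toNNReal ω)| :=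
            intervalIntegral.abs_integral_le_integral_abs u.2
        _ ≤ ∫ v in (0 : ℝ)..u, K * (1 + Y v.toNNReal ω ^ 2) ^ k :=
            intervalIntegral.integral_mono_on u.2 (hii ω _ _).abs (hWii ω _ _) fun v _ => hK _
        _ ≤ ∫ v in (0 : ℝ)..t, K * (1 + Y v.toNNReal ω ^ 2) ^ k :=
            intervalIntegral.integral_mono_interval le_rfl u.2 hut
              (ae_of_all _ fun v => by simp only [Pi.zero_apply]; positivity) (hWii ω _ _)) hA
  have hsplit : ∀ v, ∫ ω in A, (f (Y v ω) - f y - I v ω) ∂P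
      = ∫ ω in A, f (Y v ω) ∂P - ∫ _ in A, f y ∂P - ∫ ω in A, I v ω ∂P := fun v => by
    have h1 : IntegrableOn (fun ω => f (Y v ω) - f y) A P :=
      ((hfint v).sub (integrable_const _)).integrableOn
    rw [integral_sub h1 (hIint v).integrableOn,
      integral_sub (hfint v).integrableOn (integrable_const _)]
  have hI : ∫ ω in A, I t ω ∂P - ∫ ω in A, I s ω ∂P
      = ∫ q : ℝ × Ω, generator b σ ℓ f (Y q.1.toNNReal q.2)
        ∂((volume.restrict (Set.Ioc (s : ℝ) t)).prod (P.restrict A)) := by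
    rw [← integral_sub (hIint t).integrableOn (hIint s).integrableOn]
    have : ∀ ω, I t ω - I s ω
        = ∫ u in Set.Ioc (s : ℝ) t, generator b σ ℓ f (Y u.toNNReal ω) := fun ω => by
      rw [← intervalIntegral.integral_of_le (NNReal.coe_le_coe.2 hst)]
      exact intervalIntegral.integral_interval_sub_left (hii ω _ _) (hii ω _ _)
    simp_rw [this]
    refine (integral_prod_symm
      (fun q : ℝ × Ω => generator b σ ℓ f (Y q.1.toNNReal q.2)) ?_).symm
    rw [prod_restrict_right]
    exact (hint s t).restrict
  change ∫ ω in A, (f (Y t ω) - f y - I t ω) ∂P = ∫ ω in A, (f (Y s ω) - f y - I s ω) ∂P at hmart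
  rw [hsplit, hsplit] at hmart
  linarith

lemma abs_pow_le_weight (x : ℝ) (k : ℕ) : |x ^ k| ≤ 1 * (1 + x ^ 2) ^ k := by
  rw [one_mul, abs_pow]
  exact abs_pow_le_one_add_sq_pow x (by omega)

lemma IsJumpDiffusion.integrable_pow [IsProbabilityMeasure P]
    (hop : IsJumpDiffusionOperator b σ ℓ) (hpol : IsPolynomialOperator b σ ℓ)
    (hY : IsJumpDiffusion b σ ℓ 𝓕 P y Y) (k : ℕ) (t : ℝ≥0) :
    Integrable (fun ω => Y t ω ^ k) P :=
  hY.integrable_of_growth hop hpol (g := fun x => x ^ k) (by fun_prop)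
    (fun x => abs_pow_le_weight x k) t

/-- Dynkin's formula for monomials. -/
lemma IsJumpDiffusion.setIntegral_pow_eq [IsProbabilityMeasure P]
    (hop : IsJumpDiffusionOperator b σ ℓ) (hpol : IsPolynomialOperator b σ ℓ)
    (hY : IsJumpDiffusion b σ ℓ 𝓕 P y Y) (k : ℕ) {s t : ℝ≥0} (hst : s ≤ t)
    {A : Set Ω} (hA : MeasurableSet[𝓕 s] A) :
    ∫ ω in A, Y t ω ^ k ∂P = ∫ ω in A, Y s ω ^ k ∂P
      + ∫ q : ℝ × Ω, generator b σ ℓ (fun u => u ^ k) (Y q.1.toNNReal q.2)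
        ∂((volume.restrict (Set.Ioc (s : ℝ) t)).prod (P.restrict A)) := by
  let ε : ℕ → ℝ := fun N => 1 / ((N : ℝ) + 1)
  have hε : ∀ N, 0 < ε N := fun N => by simp only [ε]; positivity
  have hε1 : ∀ N, ε N ≤ 1 := fun N => by
    simp only [ε]
    rw [div_le_one (by positivity)]
    linarith [(Nat.cast_nonneg N : (0 : ℝ) ≤ N)]
  have hlim : Tendsto ε atTop (𝓝 0) := tendsto_one_div_add_atTop_nhds_zero_nat
  -- These constants serve all truncation levels at once, which gives the majorant for dominated
  -- convergence of the generator term.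
  obtain ⟨C, J, hC, hgr⟩ := hpol.exists_generator_le_of_growth k
  have hgen : ∀ N x, |generator b σ ℓ (fun u => sinTrunc (ε N) u ^ k) x|
      ≤ (k ^ 2 + k) * C * (1 + x ^ 2) ^ J := fun N =>
    hgr _ _ (contDiff_sinTrunc_pow (ε N) k) (by positivity)
      (abs_deriv_sinTrunc_pow_le (hε N) k) (abs_deriv_deriv_sinTrunc_pow_le (hε N) (hε1 N) k)
  have hpow : ∀ v, Tendsto (fun N => ∫ ω in A, sinTrunc (ε N) (Y v ω) ^ k ∂P) atTop
      (𝓝 (∫ ω in A, Y v ω ^ k ∂P)) := fun v => by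
    refine tendsto_integral_of_dominated_convergence (fun ω => |Y v ω ^ k|) (fun N => ?_)
      (hY.integrable_pow hop hpol k v).abs.restrict
      (fun N => ae_of_all _ fun ω => ?_) (ae_of_all _ fun ω => ?_)
    · exact ((contDiff_sinTrunc_pow (ε N) k).continuous.measurable.comp
        (hY.measurable v)).aestronglyMeasurable
    · rw [Real.norm_eq_abs, abs_pow, abs_pow]
      exact pow_le_pow_left₀ (abs_nonneg _) (abs_sinTrunc_le (hε N) _) k
    · exact (tendsto_sinTrunc hε hlim _).pow k
  have hprod : Tendsto (fun N => ∫ q : ℝ × Ω, generator b σ ℓ (fun u => sinTrunc (ε N) u ^ k)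
        (Y q.1.toNNReal q.2) ∂((volume.restrict (Set.Ioc (s : ℝ) t)).prod (P.restrict A))) atTop
      (𝓝 (∫ q : ℝ × Ω, generator b σ ℓ (fun u => u ^ k) (Y q.1.toNNReal q.2)
        ∂((volume.restrict (Set.Ioc (s : ℝ) t)).prod (P.restrict A)))) := by
    refine tendsto_integral_of_dominated_convergence
      (fun q => (k ^ 2 + k) * C * (1 + Y q.1.toNNReal q.2 ^ 2) ^ J) (fun N => ?_) ?_
      (fun N => ae_of_all _ fun q => hgen N _) (ae_of_all _ fun q => ?_)
    · exact ((hpol.measurable_generator hop (contDiff_sinTrunc_pow (ε N) k).continuous).comp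
        hY.measurable_uncurry).aestronglyMeasurable
    · rw [prod_restrict_right]
      exact ((hY.integrable_prod_weight hop hpol J s t).const_mul _).restrict
    · exact hpol.tendsto_generator_sinTrunc_pow hε hε1 hlim k _
  refine tendsto_nhds_unique (hpow t) (((hpow s).add hprod).congr fun N => ?_)
  exact (hY.setIntegral_eq_of_bounded hop hpol (contDiff_sinTrunc_pow (ε N) k)
    (abs_sinTrunc_pow_le (hε N) k) (hgen N) hst hA).symm

/-- The moment formula over events of the past. -/
lemma IsJumpDiffusion.setIntegral_monomials [IsProbabilityMeasure P]
    (hop : IsJumpDiffusionOperator b σ ℓ) (hpol : IsPolynomialOperator b σ ℓ)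
    (hY : IsJumpDiffusion b σ ℓ 𝓕 P y Y) (k : ℕ) {s t : ℝ≥0} (hst : s ≤ t)
    {A : Set Ω} (hA : MeasurableSet[𝓕 s] A) :
    (fun i : Fin (k + 1) => ∫ ω in A, Y t ω ^ (i : ℕ) ∂P)
      = NormedSpace.exp (((t : ℝ) - s) • generatorMatrix b σ ℓ k)
        *ᵥ fun i : Fin (k + 1) => ∫ ω in A, Y s ω ^ (i : ℕ) ∂P := by
  have hst' : (s : ℝ) ≤ t := hst
  -- Time is shifted by `s`, so that the linear integral equation starts at zero.
  let m : ℝ → Fin (k + 1) → ℝ := fun u i => ∫ ω in A, Y (s + u).toNNReal ω ^ (i : ℕ) ∂P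
  have hprod : ∀ (i : ℕ) (u v : ℝ), Integrable (fun q : ℝ × Ω => Y q.1.toNNReal q.2 ^ i)
      ((volume.restrict (Set.Ioc u v)).prod (P.restrict A)) := fun i u v => by
    rw [prod_restrict_right]
    exact (hY.integrable_prod_of_growth hop hpol (g := fun x => x ^ i) (by fun_prop)
        (fun x => abs_pow_le_weight x i) u v).restrict
  have hmint : ∀ i, ∀ u v : ℝ, u ≤ v →
      IntervalIntegrable (fun u => ∫ ω in A, Y u.toNNReal ω ^ i ∂P) volume u v := fun i u v huv => by
    rw [intervalIntegrable_iff, Set.uIoc_of_le huv]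
    exact (hprod i u v).integral_prod_left
  have hbound : ∃ K, ∀ i : Fin (k + 1), ∀ u ∈ Set.Icc 0 ((t : ℝ) - s), |m u i| ≤ K := by
    obtain ⟨C, hC, h⟩ := hY.exists_moment_le hop hpol k
    refine ⟨(1 + y ^ 2) ^ k * Real.exp (C * t), fun i u hu => ?_⟩
    have hv := (h (s + u).toNNReal)
    calc |m u i| ≤ ∫ ω in A, (1 + Y (s + u).toNNReal ω ^ 2) ^ k ∂P := by
          rw [← Real.norm_eq_abs]
          refine norm_integral_le_of_norm_le hv.1.integrableOn (ae_of_all _ fun ω => ?_)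
          rw [Real.norm_eq_abs, abs_pow]
          exact abs_pow_le_one_add_sq_pow _ (by have := i.2; omega)
      _ ≤ ∫ ω, (1 + Y (s + u).toNNReal ω ^ 2) ^ k ∂P :=
          setIntegral_le_integral hv.1 (ae_of_all _ fun ω => by
            simp only [Pi.zero_apply]; positivity)
      _ ≤ (1 + y ^ 2) ^ k * Real.exp (C * (s + u).toNNReal) := hv.2
      _ ≤ _ := by
          rw [Real.coe_toNNReal _ (by have := hu.1; positivity)]
          gcongr
          linarith [hu.2]
  obtain ⟨K, hK⟩ := hbound
  have hm0 : m 0 = fun i : Fin (k + 1) => ∫ ω in A, Y s ω ^ (i : ℕ) ∂P := by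
    simp [m]
  have hmT : m ((t : ℝ) - s) = fun i : Fin (k + 1) => ∫ ω in A, Y t ω ^ (i : ℕ) ∂P := by
    simp [m]
  rw [← hm0, ← hmT]
  refine eq_exp_mulVec_of_integral_eq _ (sub_nonneg.2 hst') (fun i => ?_) hK fun i u hu => ?_
  · have := (hmint i (s + 0) (s + ((t : ℝ) - s)) (by linarith)).comp_add_left s
    simpa [m] using this
  · have hsu : s ≤ (s + u).toNNReal := by
      rw [← NNReal.coe_le_coe, Real.coe_toNNReal _ (by have := hu.1; positivity)]
      linarith [hu.1]
    have h1 := hY.setIntegral_pow_eq hop hpol i hsu hA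
    rw [hm0]
    simp only [m]
    rw [h1]
    congr 1
    simp_rw [hpol.generator_pow k i]
    rw [integral_finsetSum (f := fun (j : Fin (k + 1)) (q : ℝ × Ω) =>
      generatorMatrix b σ ℓ k i j * Y q.1.toNNReal q.2 ^ (j : ℕ)) _
      fun j _ => (hprod j _ _).const_mul _]
    simp only [Matrix.mulVec, dotProduct]
    rw [intervalIntegral.integral_finsetSum]
    · refine Finset.sum_congr rfl fun j _ => ?_
      rw [integral_const_mul, intervalIntegral.integral_const_mul, integral_prod _ (hprod j _ _),
        ← intervalIntegral.integral_of_le (NNReal.coe_le_coe.2 hsu),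
        Real.coe_toNNReal _ (by have := hu.1; positivity)]
      congr 1
      have := intervalIntegral.integral_comp_add_left (a := 0) (b := u)
        (fun v : ℝ => ∫ ω in A, Y v.toNNReal ω ^ (j : ℕ) ∂P) (s : ℝ)
      rw [this, add_zero]
    · intro j _
      have := (hmint j (s + 0) (s + u) (by linarith [hu.1])).comp_add_left s
      have h2 : IntervalIntegrable (fun v => m v j) volume 0 u := by simpa [m] using this
      exact h2.const_mul _

/-- The moment formula `E[H_k(Y(t)) | 𝓕_s] = e^{G_k (t-s)} H_k(Y(s))`. -/
lemma IsJumpDiffusion.condExp_pow [IsProbabilityMeasure P]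
    (hop : IsJumpDiffusionOperator b σ ℓ) (hpol : IsPolynomialOperator b σ ℓ)
    (hY : IsJumpDiffusion b σ ℓ 𝓕 P y Y) (k : ℕ) {s t : ℝ≥0} (hst : s ≤ t) (i : Fin (k + 1)) :
    P[fun ω => Y t ω ^ (i : ℕ) | 𝓕 s] =ᵐ[P] fun ω =>
      (NormedSpace.exp (((t : ℝ) - s) • generatorMatrix b σ ℓ k)
        *ᵥ fun j : Fin (k + 1) => Y s ω ^ (j : ℕ)) i := by
  have hint := fun v (j : ℕ) => hY.integrable_pow hop hpol j v
  set E := NormedSpace.exp (((t : ℝ) - s) • generatorMatrix b σ ℓ k) with hE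
  have hsum : Integrable (fun ω => (E *ᵥ fun j : Fin (k + 1) => Y s ω ^ (j : ℕ)) i) P := by
    simp only [Matrix.mulVec, dotProduct]
    exact integrable_finsetSum _ fun j _ => (hint s j).const_mul _
  refine (ae_eq_condExp_of_forall_setIntegral_eq (𝓕.le s) (hint t i)
    (fun A _ _ => hsum.integrableOn) (fun A hA _ => ?_) ?_).symm
  · have h := congrFun (hY.setIntegral_monomials hop hpol k hst hA) i
    rw [h]
    simp only [Matrix.mulVec, dotProduct]
    rw [integral_finsetSum (f := fun (j : Fin (k + 1)) ω => E i j * Y s ω ^ (j : ℕ)) _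
      fun j _ => ((hint s j).const_mul _).integrableOn]
    simp_rw [integral_const_mul]
    rfl
  · refine StronglyMeasurable.aestronglyMeasurable ?_
    simp only [Matrix.mulVec, dotProduct]
    refine Finset.stronglyMeasurable_fun_sum _ fun j _ => ?_
    exact ((hY.adapted s).pow _).const_mul _

/-! ### Integrability of products -/

/-- The random variable `X` has finite moments of all orders. -/
def HasMoments (P : Measure Ω) (X : Ω → ℝ) : Prop :=
  AEStronglyMeasurable X P ∧ ∀ k : ℕ, Integrable (fun ω => |X ω| ^ k) P

lemma HasMoments.integrable {X : Ω → ℝ} (hX : HasMoments P X) : Integrable X P :=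
  (hX.2 1).mono' hX.1 (ae_of_all _ fun ω => by simp)

/-- By `ab ≤ a² + b²`, a moment of the product is controlled by moments of twice the order.
Requiring all orders thus gives a class closed under products, which mere integrability would not.
-/
lemma HasMoments.mul {X Z : Ω → ℝ} (hX : HasMoments P X) (hZ : HasMoments P Z) :
    HasMoments P (fun ω => X ω * Z ω) := by
  refine ⟨hX.1.mul hZ.1, fun k => ?_⟩
  refine ((hX.2 (2 * k)).add (hZ.2 (2 * k))).mono'
    (((hX.1.mul hZ.1).norm).pow k) (ae_of_all _ fun ω => ?_)
  rw [Real.norm_of_nonneg (by positivity), abs_mul, mul_pow]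
  simp only [Pi.add_apply]
  have h1 : |X ω| ^ (2 * k) = (|X ω| ^ k) ^ 2 := by ring
  have h2 : |Z ω| ^ (2 * k) = (|Z ω| ^ k) ^ 2 := by ring
  rw [h1, h2]
  nlinarith [sq_nonneg (|X ω| ^ k - |Z ω| ^ k), sq_nonneg (|X ω| ^ k), sq_nonneg (|Z ω| ^ k)]

lemma HasMoments.one [IsFiniteMeasure P] : HasMoments P (fun _ => (1 : ℝ)) :=
  ⟨aestronglyMeasurable_const, fun k => by simp⟩

lemma HasMoments.prod [IsFiniteMeasure P] {X : ℕ → Ω → ℝ} {j : ℕ}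
    (hX : ∀ i < j, HasMoments P (X i)) :
    HasMoments P (fun ω => ∏ i ∈ Finset.range j, X i ω) := by
  induction j with
  | zero => simpa using HasMoments.one
  | succ j ih =>
    simp only [Finset.prod_range_succ]
    exact (ih fun i hi => hX i (by omega)).mul (hX j (by omega))

lemma IsJumpDiffusion.hasMoments_eval [IsProbabilityMeasure P]
    (hop : IsJumpDiffusionOperator b σ ℓ) (hpol : IsPolynomialOperator b σ ℓ)
    (hY : IsJumpDiffusion b σ ℓ 𝓕 P y Y) (p : ℝ[X]) (t : ℝ≥0) :
    HasMoments P (fun ω => p.eval (Y t ω)) := by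
  refine ⟨(p.continuous.measurable.comp (hY.measurable t)).aestronglyMeasurable, fun k => ?_⟩
  obtain ⟨C, hC, h⟩ := exists_abs_eval_le p (k := p.natDegree) (by omega)
  refine hY.integrable_of_growth hop hpol (g := fun x => |p.eval x| ^ k) (K := C ^ k)
    (k := p.natDegree * k) (p.continuous.abs.pow k).measurable (fun x => ?_) t
  rw [abs_pow, abs_abs, pow_mul, ← mul_pow]
  exact pow_le_pow_left₀ (abs_nonneg _) (h x) k

/-! ### The correlator formula -/

/-- Conditional expectation of linear functionals of `H_n(Y(t))^{⊗(r+1)}`. -/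
lemma IsJumpDiffusion.condExp_tensorMonomials [IsProbabilityMeasure P]
    (hop : IsJumpDiffusionOperator b σ ℓ) (hpol : IsPolynomialOperator b σ ℓ)
    (hY : IsJumpDiffusion b σ ℓ 𝓕 P y Y) (n r : ℕ) {s t : ℝ≥0} (hst : s ≤ t)
    (c : Fin ((n + 1) ^ (r + 1)) → ℝ) :
    P[fun ω => tensorMonomials n (r + 1) (Y t ω) ⬝ᵥ c | 𝓕 s] =ᵐ[P] fun ω =>
      (dupExpElim b σ ℓ n r ((t : ℝ) - s) *ᵥ tensorMonomials n (r + 1) (Y s ω)) ⬝ᵥ c := by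
  -- A linear functional `c` of the tensor power is a polynomial of degree at most `n(r+1)` with
  -- coefficient vector `cᵀ D`, to which the moment formula applies.
  let d : Fin (n * (r + 1) + 1) → ℝ := c ᵥ* dupMatrix n r
  have hd : ∀ v : Fin (n * (r + 1) + 1) → ℝ, (dupMatrix n r *ᵥ v) ⬝ᵥ c = ∑ i, d i * v i := by
    intro v
    rw [dotProduct_comm, Matrix.dotProduct_mulVec]; rfl
  have hl : (fun ω => tensorMonomials n (r + 1) (Y t ω) ⬝ᵥ c)
      = ∑ i, d i • fun ω => Y t ω ^ (i : ℕ) := by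
    ext ω
    rw [← dupMatrix_mulVec, hd]
    simp
  rw [hl]
  refine (condExp_finsetSum (f := fun (i : Fin (n * (r + 1) + 1)) =>
    d i • fun ω => Y t ω ^ (i : ℕ)) (fun i _ => (hY.integrable_pow hop hpol i t).smul (d i)) _).trans ?_
  have h1 : ∀ᵐ ω ∂P, ∀ i : Fin (n * (r + 1) + 1),
      P[d i • fun ω => Y t ω ^ (i : ℕ) | 𝓕 s] ω = d i *
      (NormedSpace.exp (((t : ℝ) - s) • generatorMatrix b σ ℓ (n * (r + 1)))
        *ᵥ fun j : Fin (n * (r + 1) + 1) => Y s ω ^ (j : ℕ)) i := by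
    rw [ae_all_iff]
    intro i
    filter_upwards [hY.condExp_pow hop hpol (n * (r + 1)) hst i,
      condExp_smul (μ := P) (d i) (fun ω => Y t ω ^ (i : ℕ)) (𝓕 s)] with ω h1 h2
    rw [h2, Pi.smul_apply, h1, smul_eq_mul]
  filter_upwards [h1] with ω hω
  rw [dupExpElim_mulVec, hd, Finset.sum_apply]
  exact Finset.sum_congr rfl fun i _ => hω i

/-- One step of the backward recursion for correlators: if `c` represents the conditional
expectation of `Z` at time `t`, then multiplying by `p(Y(t))` and conditioning at `s ≤ t` amounts
to applying `M(t-s)` and `I ⊗^r p`. -/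
lemma IsJumpDiffusion.condExp_eval_mul [IsProbabilityMeasure P]
    (hop : IsJumpDiffusionOperator b σ ℓ) (hpol : IsPolynomialOperator b σ ℓ)
    (hY : IsJumpDiffusion b σ ℓ 𝓕 P y Y) (n r : ℕ) {s t : ℝ≥0} (hst : s ≤ t)
    {p : ℝ[X]} (hp : p.natDegree ≤ n) {Z : Ω → ℝ} (hZ : HasMoments P Z)
    {c : Fin ((n + 1) ^ r) → ℝ}
    (hc : P[Z | 𝓕 t] =ᵐ[P] fun ω => tensorMonomials n r (Y t ω) ⬝ᵥ c) :
    P[fun ω => p.eval (Y t ω) * Z ω | 𝓕 s] =ᵐ[P] fun ω =>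
      (dupExpElim b σ ℓ n r ((t : ℝ) - s) *ᵥ tensorMonomials n (r + 1) (Y s ω))
        ⬝ᵥ (idKronCoeff n r p *ᵥ c) := by
  -- The polynomial is known at time `t` and is pulled out; multiplying by it adds one tensor factor
  -- contracted with its coefficients. The tower property then leads to time `s`.
  have h1 : P[fun ω => p.eval (Y t ω) * Z ω | 𝓕 t] =ᵐ[P]
      fun ω => tensorMonomials n (r + 1) (Y t ω) ⬝ᵥ (idKronCoeff n r p *ᵥ c) := by
    have hmeas : StronglyMeasurable[𝓕 t] (fun ω => p.eval (Y t ω)) :=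
      p.continuous.comp_stronglyMeasurable (hY.adapted t)
    have hpull := condExp_mul_of_stronglyMeasurable_left (μ := P) hmeas
      ((hY.hasMoments_eval hop hpol p t).mul hZ).integrable hZ.integrable
    refine hpull.trans ?_
    filter_upwards [hc] with ω hω
    rw [Matrix.dotProduct_mulVec, tensorMonomials_vecMul_idKronCoeff n r p hp, smul_dotProduct,
      Pi.mul_apply, hω, smul_eq_mul]
  refine (condExp_condExp_of_le (𝓕.mono hst) (𝓕.le t)).symm.trans ?_
  exact (condExp_congr_ae h1).trans (hY.condExp_tensorMonomials hop hpol n r hst _)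

lemma corrFormula_apply (n m : ℕ) (p : ℕ → ℝ[X]) (t : ℝ≥0) (s : ℕ → ℝ≥0)
    (M : (r : ℕ) → ℝ → Matrix (Fin ((n + 1) ^ (r + 1))) (Fin ((n + 1) ^ (r + 1))) ℝ) (x : ℝ) :
    corrFormula n m p t s M x 0 0 = (M m ((s 0 : ℝ) - t) *ᵥ vecPow n m x) ⬝ᵥ
      (idKronCoeff n m (p m) *ᵥ fun k => descProd n
        (fun j => (M j ((s (m - j) : ℝ) - s (m - j - 1)))ᵀ * idKronCoeff n j (p j)) m k 0) := by
  rw [corrFormula, Matrix.mul_apply, Matrix.dotProduct_mulVec]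
  refine Finset.sum_congr rfl fun k _ => ?_
  rw [coeffCol_mul_vecInv]

/-- The correlator formula for every family `M^{(r)}(τ)` that acts on `vec (X_n^{(r)}(x))` like
`D e^{Gτ} E`. -/
lemma IsJumpDiffusion.condExp_prod_eq_corrFormula [IsProbabilityMeasure P]
    (hop : IsJumpDiffusionOperator b σ ℓ) (hpol : IsPolynomialOperator b σ ℓ)
    (hY : IsJumpDiffusion b σ ℓ 𝓕 P y Y) (m n : ℕ) {p : ℕ → ℝ[X]}
    (hp : ∀ k ≤ m, (p k).natDegree ≤ n) {t : ℝ≥0} {s : ℕ → ℝ≥0} (hts : t ≤ s 0)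
    (hs : ∀ k < m, s k ≤ s (k + 1))
    (M : (r : ℕ) → ℝ → Matrix (Fin ((n + 1) ^ (r + 1))) (Fin ((n + 1) ^ (r + 1))) ℝ)
    (hM : ∀ r τ x, M r τ *ᵥ vecPow n r x = dupExpElim b σ ℓ n r τ *ᵥ vecPow n r x) :
    P[fun ω => ∏ k ∈ Finset.range (m + 1), (p (m - k)).eval (Y (s k) ω) | 𝓕 t]
      =ᵐ[P] (fun ω => corrFormula n m p t s M (Y t ω) 0 0) := by
  let F := fun j : ℕ => (M j ((s (m - j) : ℝ) - s (m - j - 1)))ᵀ * idKronCoeff n j (p j)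
  -- The product of the factors at the last `j` times. The induction conditions it on time `s (m -
  -- j)`, which precedes all of them once `j > 0`.
  let Z : ℕ → Ω → ℝ := fun j ω => ∏ i ∈ Finset.range j, (p i).eval (Y (s (m - i)) ω)
  have hZ : ∀ j, HasMoments P (Z j) := fun j =>
    HasMoments.prod fun i _ => hY.hasMoments_eval hop hpol (p i) (s (m - i))
  have hZsucc : ∀ j, Z (j + 1) = fun ω => (p j).eval (Y (s (m - j)) ω) * Z j ω := fun j => by
    ext ω
    simp only [Z, Finset.prod_range_succ]
    ring
  have hM' : ∀ r τ x, M r τ *ᵥ tensorMonomials n (r + 1) x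
      = dupExpElim b σ ℓ n r τ *ᵥ tensorMonomials n (r + 1) x := fun r τ x => by
    rw [← vecPow_eq_tensorMonomials, hM]
  have key : ∀ j ≤ m, P[Z j | 𝓕 (s (m - j))] =ᵐ[P] fun ω =>
      tensorMonomials n j (Y (s (m - j)) ω) ⬝ᵥ fun k => descProd n F j k 0 := by
    intro j
    induction j with
    | zero =>
      intro _
      have h0 : Z 0 = fun _ => 1 := by ext ω; simp [Z]
      rw [h0, condExp_const (𝓕.le _)]
      refine ae_of_all _ fun ω => ?_
      have hu : ∀ k : Fin ((n + 1) ^ 0), k = 0 := fun k => by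
        ext; have := k.2; simp only [pow_zero] at this; simp; omega
      simp only [dotProduct, tensorMonomials_zero, descProd, one_mul]
      rw [Finset.sum_eq_single 0 (fun k _ hk => absurd (hu k) hk)
        (fun h => absurd (Finset.mem_univ _) h), Matrix.one_apply_eq]
    | succ j ih =>
      intro hj
      have hle : s (m - (j + 1)) ≤ s (m - j) := by
        have h := hs (m - (j + 1)) (by omega)
        rwa [show m - (j + 1) + 1 = m - j by omega] at h
      have h := hY.condExp_eval_mul hop hpol n j hle (hp j (by omega)) (hZ j) (ih (by omega))
      rw [hZsucc]
      refine h.trans (ae_of_all _ fun ω => ?_)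
      have hF : (fun k => descProd n F (j + 1) k 0)
          = (M j ((s (m - j) : ℝ) - s (m - j - 1)))ᵀ *ᵥ
            (idKronCoeff n j (p j) *ᵥ fun k => descProd n F j k 0) := by
        rw [Matrix.mulVec_mulVec]; rfl
      simp only
      -- Moving `M` from the state vector to the coefficient vector is what creates the transposes
      -- in the product.
      rw [hF, ← hM', Matrix.dotProduct_mulVec _ (M j _)ᵀ, Matrix.vecMul_transpose]
      rfl
  have hprod : (fun ω => ∏ k ∈ Finset.range (m + 1), (p (m - k)).eval (Y (s k) ω))
      = Z (m + 1) := by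
    ext ω
    simp only [Z]
    rw [← Finset.prod_range_reflect]
    refine Finset.prod_congr rfl fun i hi => ?_
    have : i ≤ m := by simpa [Nat.lt_succ_iff] using hi
    rw [show m + 1 - 1 - i = m - i by omega, show m - (m - i) = i by omega]
  have hm := key m le_rfl
  rw [Nat.sub_self] at hm
  -- The last step conditions on `𝓕 t`; here `M` stays on the side of the state, so the leading
  -- exponential is not transposed.
  have h := hY.condExp_eval_mul hop hpol n m hts (hp m le_rfl) (hZ m) hm
  rw [hprod, hZsucc, Nat.sub_self]
  refine h.trans (ae_of_all _ fun ω => ?_)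
  simp only
  rw [corrFormula_apply, hM, vecPow_eq_tensorMonomials]

end

end PolyCorr

open PolyCorr
theorem theorem4p5 {Ω : Type*} {mΩ : MeasurableSpace Ω} (P : Measure Ω) [IsProbabilityMeasure P]
    (𝓕 : Filtration ℝ≥0 mΩ) (b σ : ℝ → ℝ) (ℓ : Kernel ℝ ℝ)
    (hop : IsJumpDiffusionOperator b σ ℓ) (hpol : IsPolynomialOperator b σ ℓ)
    (y : ℝ) (Y : ℝ≥0 → Ω → ℝ) (hY : IsJumpDiffusion b σ ℓ 𝓕 P y Y)
    (m n : ℕ) (p : ℕ → ℝ[X]) (hp : ∀ k ≤ m, (p k).natDegree ≤ n)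
    (t : ℝ≥0) (s : ℕ → ℝ≥0) (hts : t < s 0) (hs : ∀ k < m, s k < s (k + 1)) :
    -- the generator matrices exist
    (∀ k, IsGeneratorMatrix b σ ℓ k (generatorMatrix b σ ℓ k))
    -- the product is integrable, and its conditional expectation is given by the formula
    ∧ Integrable (fun ω => ∏ k ∈ Finset.range (m + 1), (p (m - k)).eval (Y (s k) ω)) P
    ∧ P[fun ω => ∏ k ∈ Finset.range (m + 1), (p (m - k)).eval (Y (s k) ω) | 𝓕 t]
        =ᵐ[P] (fun ω => corrFormula n m p t s (corrExp b σ ℓ n) (Y t ω) 0 0)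
    -- the formula remains valid with `D e^{Gτ} E` in place of every `e^{G̃τ}`
    ∧ P[fun ω => ∏ k ∈ Finset.range (m + 1), (p (m - k)).eval (Y (s k) ω) | 𝓕 t]
        =ᵐ[P] (fun ω => corrFormula n m p t s (dupExpElim b σ ℓ n) (Y t ω) 0 0)
    -- `e^{G̃τ} = D e^{Gτ} E` as operators on `vec (X_n^{(r)}(x))`
    ∧ (∀ r : ℕ, ∀ τ x : ℝ,
        corrExp b σ ℓ n r τ *ᵥ vecPow n r x = dupExpElim b σ ℓ n r τ *ᵥ vecPow n r x)
    -- the corresponding identity of matrices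
    ∧ (∀ r : ℕ, ∀ τ : ℝ,
        corrExp b σ ℓ n r τ = dupExpElim b σ ℓ n r τ + (1 - dupMatrix n r * elimMatrix n r))
    -- `G̃_n^{(0)} = G_n`
    ∧ corrGenerator b σ ℓ n 0
        = mcast (by simp) (by simp) (generatorMatrix b σ ℓ n) := by

  have hM := corrExp_mulVec_vecPow b σ ℓ n
  have hprod : HasMoments P (fun ω => ∏ k ∈ Finset.range (m + 1), (p (m - k)).eval (Y (s k) ω)) :=
    HasMoments.prod fun k _ => hY.hasMoments_eval hop hpol (p (m - k)) (s k)
  exact ⟨hpol.isGeneratorMatrix, hprod.integrable,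
    hY.condExp_prod_eq_corrFormula hop hpol m n hp hts.le (fun k hk => (hs k hk).le) _ hM,
    hY.condExp_prod_eq_corrFormula hop hpol m n hp hts.le (fun k hk => (hs k hk).le) _
      (fun _ _ _ => rfl), hM, corrExp_eq b σ ℓ n, corrGenerator_zero b σ ℓ n⟩
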